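/- Let $E:[0,\infty)\times\mathbb R^2\to\mathbb R^2$ be an electric field. Write $v^\perp=(-v_2,v_1)$ for $v=(v_1,v_2)\in\mathbb R^2$ and let $\|\cdot\|$ be the Euclidean norm on $\mathbb R^2$. For $\varepsilon>0$ and initial data $x^0,v^0\in\mathbb R^2$ let $(x_\varepsilon,v_\varepsilon)$ be the solution on $[0,\infty)$ of $$\varepsilon x_\varepsilon'(t)=v_\varepsilon(t),\qquad \varepsilon v_\varepsilon'(t)=E(t,x_\varepsilon(t))-\frac{v_\varepsilon^\perp(t)}{\varepsilon},\qquad x_\varepsilon(0)=x^0,\quad v_\varepsilon(0)=v^0,$$ and set $y_\varepsilon(t)=x_\varepsilon(t)-\varepsilon v_\varepsilon^\perp(t)$. For a time step $\Delta t>0$ put $t_n=n\Delta t$ and consider the scheme, for $n\ge 0$, $$\frac{v_\varepsilon^{n+1}-v_\varepsilon^n}{\Delta t}=\frac1\varepsilon E\big(t_n,y_\varepsilon^n+\varepsilon(v_\varepsilon^n)^\perp\big)-\frac1{\varepsilon^2}(v_\varepsilon^{n+1})^\perp,\qquad \frac{y_\varepsilon^{n+1}-y_\varepsilon^n}{\Delta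 t}=-E^\perp\big(t_n,y_\varepsilon^n+\varepsilon(v_\varepsilon^{n+1})^\perp\big),$$ started from $v_\varepsilon^0=v^0$, $y_\varepsilon^0=x^0-\varepsilon(v^0)^\perp$; put $x_\varepsilon^n=y_\varepsilon^n+\varepsilon(v_\varepsilon^n)^\perp$. **Theorem.** For all $\varepsilon,\Delta t>0$ and all $x^0,v^0$, the scheme possesses a unique solution $(y_\varepsilon^n,v_\varepsilon^n)_{n\ge0}$. Moreover: (i) If $E\in W^{1,\infty}((0,\infty)\times\mathbb R^2)$ (all first weak derivatives in $(t,x)$, and $E$ itself, are essentially bounded; $E$ is its representative that is continuous on $[0,\infty)\times\mathbb R^2$), and $K_x=\|D_xE\|_{L^\infty}$ (Euclidean operator norm), then there is a constant $C$ depending only on $E$ such that for all $n\ge0$, $\Delta t>0$, $\varepsilon>0$, $x^0,v^0\in\mathbb R^2$, $$\|x_\varepsilon^n-x_\varepsilon(t_n)\|\le C\,(1+t_n^3)\,e^{(2+K_x\Delta t)K_xt_n}\,(1+\|v^0\|+\varepsilon)\,\min\Big(\frac{\Delta t}{\varepsilon^3}(1+\varepsilon^2),\ \Delta t+\varepsilon\Big).$$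 (ii) If $E\in W^{2,\infty}((0,\infty)\times\mathbb R^2)$ (all weak derivatives in $(t,x)$ up to order two are essentially bounded; $E$ continuous as in (i)), then, with $K_x$ as in (i), there is a constant $C$ depending only on $E$ such that for all $n\ge0$, $\Delta t>0$, $\varepsilon>0$, $x^0,v^0\in\mathbb R^2$, $$\|y_\varepsilon^n-y_\varepsilon(t_n)\|\le C\,(1+t_n^4)\,e^{(2+K_x\Delta t)K_xt_n}\,(1+\|v^0\|^2+\varepsilon^2)\,\min\Big(\frac{\Delta t}{\varepsilon^3}(1+\varepsilon),\ \Delta t+\varepsilon^2\Big).$$ -/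

import Mathlib

open MeasureTheory Set
open scoped ENNReal ContDiff

/-- The Euclidean plane `ℝ²`. -/
abbrev Plane : Type := EuclideanSpace ℝ (Fin 2)

/-- Points `(t, x)` of time and space. -/
abbrev SpaceTime : Type := ℝ × Plane

/-- The rotation `v^⊥ = J v = (-v₂, v₁)`. -/
noncomputable def perp (v : Plane) : Plane := !₂[-(v 1), v 0]

section Sobolev

variable {F : Type} [NormedAddCommGroup F] [NormedSpace ℝ F]

/-- The open half space `(0, ∞) × ℝ²` of positive times. -/
def positiveTimes : Set SpaceTime := Ioi 0 ×ˢ univ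

/-- `g` is the weak (distributional) total derivative of `f` on `(0, ∞) × ℝ²`: integration by
parts against all smooth `φ` with compact support inside this open set, in all directions `w`. -/
def IsWeakDeriv (f : SpaceTime → F) (g : SpaceTime → SpaceTime →L[ℝ] F) : Prop :=
  LocallyIntegrableOn f positiveTimes ∧ LocallyIntegrableOn g positiveTimes ∧
    ∀ φ : SpaceTime → ℝ, ContDiff ℝ ∞ φ → HasCompactSupport φ → tsupport φ ⊆ positiveTimes →
      ∀ w : SpaceTime,
        ∫ z in positiveTimes, (fderiv ℝ φ z w) • f z = -∫ z in positiveTimes, φ z • g z w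

open Classical in
/-- The weak total derivative (a representative of it, all of them being equal almost everywhere
on `(0, ∞) × ℝ²`); it is `0` by convention if there is none. -/
noncomputable def weakDeriv (f : SpaceTime → F) : SpaceTime → SpaceTime →L[ℝ] F :=
  if h : ∃ g, IsWeakDeriv f g then h.choose else 0

/-- Essential boundedness on `(0, ∞) × ℝ²`. -/
def MemLInfty (f : SpaceTime → F) : Prop :=
  MemLp f ∞ (volume.restrict positiveTimes)

/-- The `L^∞` norm on `(0, ∞) × ℝ²`. -/
noncomputable def lInftyNorm (f : SpaceTime → F) : ℝ :=
  (eLpNorm f ∞ (volume.restrict positiveTimes)).toReal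

end Sobolev

/-- The Sobolev space `W^{k,∞}((0, ∞) × ℝ²; F)`: all weak derivatives in `(t, x)` up to order `k`
exist and are essentially bounded. -/
def MemSobolevInfty : ℕ → ∀ {F : Type} [NormedAddCommGroup F] [NormedSpace ℝ F],
    (SpaceTime → F) → Prop
  | 0, _, _, _, f => MemLInfty f
  | k + 1, _, _, _, f =>
      MemLInfty f ∧ (∃ g, IsWeakDeriv f g) ∧ MemSobolevInfty k (weakDeriv f)

/-- An electric field on `[0, ∞) × ℝ²` of class `W^{k,∞}`. Since the field is evaluated pointwise
(also at time `0`), `E` has to be the representative that is continuous up to `t = 0`. -/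
def IsSobolevField (k : ℕ) (E : SpaceTime → Plane) : Prop :=
  ContinuousOn E (Ici 0 ×ˢ univ) ∧ MemSobolevInfty k E

/-- `K_x = ‖D_x E‖_{L^∞}`, with the operator norm for the Euclidean norm of `ℝ²`. -/
noncomputable def Kx (E : SpaceTime → Plane) : ℝ :=
  lInftyNorm fun z => (weakDeriv E z).comp (ContinuousLinearMap.inr ℝ ℝ Plane)

/-- `(x, v)` solves, for all `t ≥ 0`, the characteristic system
`ε x' = v`, `ε v' = E(t, x) - v^⊥ / ε` with `x(0) = x₀`, `v(0) = v₀`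
(one-sided derivatives at `t = 0`). -/
structure IsCharacteristic (E : SpaceTime → Plane) (ε : ℝ) (x₀ v₀ : Plane)
    (x v : ℝ → Plane) : Prop where
  init_x : x 0 = x₀
  init_v : v 0 = v₀
  deriv_x : ∀ t : ℝ, 0 ≤ t → HasDerivWithinAt x (ε⁻¹ • v t) (Ici 0) t
  deriv_v : ∀ t : ℝ, 0 ≤ t →
    HasDerivWithinAt v (ε⁻¹ • (E (t, x t) - ε⁻¹ • perp (v t))) (Ici 0) t

/-- `(y n, v n)` solves the first-order IMEX scheme written on the guiding center variable, with
time step `Δt`, `t_n = n Δt`, started from `v⁰ = v₀` and `y⁰ = x₀ - ε v₀^⊥`. -/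
structure IsScheme (E : SpaceTime → Plane) (ε Δt : ℝ) (x₀ v₀ : Plane)
    (y v : ℕ → Plane) : Prop where
  init_y : y 0 = x₀ - ε • perp v₀
  init_v : v 0 = v₀
  step_v : ∀ n : ℕ, Δt⁻¹ • (v (n + 1) - v n) =
    ε⁻¹ • E (n * Δt, y n + ε • perp (v n)) - (ε ^ 2)⁻¹ • perp (v (n + 1))
  step_y : ∀ n : ℕ, Δt⁻¹ • (y (n + 1) - y n) =
    -perp (E (n * Δt, y n + ε • perp (v (n + 1))))

/-! Solvability is linear algebra: write J for the rotation. The implicit velocity step applies `1 +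
cJ` with `c = Δt / ε²`, and `J² = -1` makes this operator invertible and norm-expanding. The guiding
center step is then explicit.

For the estimates, mollification turns the Sobolev hypotheses into pointwise ones without losing
constants: `E` is bounded, Lipschitz in time, and Lipschitz in space with constant exactly `Kx E`
(`IsSobolevField.isLipField`). It is also a uniform limit of smooth fields obeying the same
derivative bounds.

The velocities stay bounded independently of stiffness because `v + ε E^⊥` obeys a rotation equation
with a non-stiff source, both for the flow and for the scheme (the two `norm_v_le`). With these
bounds, each entry of the minimum is a consistency estimate followed by a discrete Gronwall
argument. The entry in `Δt / ε³` is the usual analysis of the full scheme, with velocity errors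
weighted by `ε` (`IsScheme.error_le`). For the other entry of (i), exact and discrete guiding
centers are both compared with the Euler step of `y' = -E^⊥(t, y)`, at the cost of a defect of order
`ε` from the displacement `ε v^⊥` (`IsScheme.guidingCenter_error_le`).

For (ii) that defect must be averaged. Its linear part is `D_x E (ε v^⊥)`, and the velocity equation
gives `ε v^⊥ = ε² E - ε³ v'`. Up to terms of order `ε²` it is thus the time derivative of `-ε³ D_x
E(t, y) v`. Moving this derivative to the left yields the corrected center `y - ε³ (D_x E(t, y)
v)^⊥`, which follows the limiting dynamics to order `ε²`. The implicit velocity step gives the same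
cancellation by discrete summation by parts (the two `consistency_corrected`). -/

/-! ### Mollification on the half space and weak derivatives. -/

section Mollification

instance isAddHaarMeasure_spaceTime : (volume : Measure SpaceTime).IsAddHaarMeasure :=
  inferInstanceAs ((volume : Measure ℝ).prod (volume : Measure Plane)).IsAddHaarMeasure

theorem isOpen_positiveTimes : IsOpen positiveTimes := isOpen_Ioi.prod isOpen_univ

theorem mem_positiveTimes {z : SpaceTime} : z ∈ positiveTimes ↔ 0 < z.1 := by
  simp [positiveTimes]

variable {F : Type} [NormedAddCommGroup F]

theorem MemLInfty.locallyIntegrable_indicator {f : SpaceTime → F} (hf : MemLInfty f) :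
    LocallyIntegrable (positiveTimes.indicator f) := by
  have : MemLp (positiveTimes.indicator f) ∞ volume :=
    (memLp_indicator_iff_restrict isOpen_positiveTimes.measurableSet).2 hf
  exact this.locallyIntegrable le_top

theorem MemLInfty.ae_norm_le {f : SpaceTime → F} (hf : MemLInfty f) :
    ∀ᵐ z ∂(volume.restrict positiveTimes), ‖f z‖ ≤ lInftyNorm f := by
  have hfin : eLpNorm f ⊤ (volume.restrict positiveTimes) ≠ ⊤ := hf.2.ne
  filter_upwards [enorm_ae_le_eLpNormEssSup f (volume.restrict positiveTimes)] with z hz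
  rw [← eLpNorm_exponent_top] at hz
  have := ENNReal.toReal_mono hfin hz
  simpa [lInftyNorm] using this

variable [NormedSpace ℝ F]

/-- Convolution of `f`, extended by zero to negative times, with a smooth bump function. -/
noncomputable def mollify (φ : ContDiffBump (0 : SpaceTime)) (f : SpaceTime → F) :
    SpaceTime → F :=
  convolution (positiveTimes.indicator f) (φ.normed volume)
    (ContinuousLinearMap.lsmul ℝ ℝ).flip volume

theorem mollify_apply (φ : ContDiffBump (0 : SpaceTime)) (f : SpaceTime → F) (x : SpaceTime) :
    mollify φ f x = ∫ z in positiveTimes, φ.normed volume (x - z) • f z := by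
  rw [mollify, convolution_def, ← integral_indicator isOpen_positiveTimes.measurableSet]
  congr 1
  ext z
  by_cases hz : z ∈ positiveTimes <;> simp [hz]

theorem integrable_bump_smul (φ : ContDiffBump (0 : SpaceTime)) {f : SpaceTime → F}
    (hf : MemLInfty f) (x : SpaceTime) :
    IntegrableOn (fun z => φ.normed volume (x - z) • f z) positiveTimes := by
  have h1 : Integrable (fun z => φ.normed volume (x - z)) volume :=
    (φ.integrable_normed (μ := volume)).comp_sub_left x
  exact h1.integrableOn.smul_of_top_left hf

theorem integral_bump_le_one (φ : ContDiffBump (0 : SpaceTime)) (x : SpaceTime) :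
    ∫ z in positiveTimes, φ.normed volume (x - z) ≤ 1 := by
  have h1 : Integrable (fun z => φ.normed volume (x - z)) volume :=
    (φ.integrable_normed (μ := volume)).comp_sub_left x
  calc ∫ z in positiveTimes, φ.normed volume (x - z)
      ≤ ∫ z, φ.normed volume (x - z) :=
        setIntegral_le_integral h1 (Filter.Eventually.of_forall fun z => φ.nonneg_normed _)
    _ = 1 := by
        rw [integral_sub_left_eq_self (fun z => φ.normed volume z) volume x, φ.integral_normed]

/-- The kernel is nonnegative with mass at most one on the half space, so averaging loses no
constant. This is what keeps `Kx E` exact in the final exponent. -/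
theorem norm_integral_bump_smul_le (φ : ContDiffBump (0 : SpaceTime)) {f : SpaceTime → F} {c : ℝ}
    (hc : 0 ≤ c) (hf : ∀ᵐ z ∂(volume.restrict positiveTimes), ‖f z‖ ≤ c) (x : SpaceTime) :
    ‖∫ z in positiveTimes, φ.normed volume (x - z) • f z‖ ≤ c := by
  have h1 : Integrable (fun z => φ.normed volume (x - z)) volume :=
    (φ.integrable_normed (μ := volume)).comp_sub_left x
  calc ‖∫ z in positiveTimes, φ.normed volume (x - z) • f z‖
      ≤ ∫ z in positiveTimes, φ.normed volume (x - z) * c := by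
        refine norm_integral_le_of_norm_le (h1.integrableOn.mul_const c) ?_
        filter_upwards [hf] with z hz
        rw [norm_smul, Real.norm_of_nonneg (φ.nonneg_normed _)]
        exact mul_le_mul_of_nonneg_left hz (φ.nonneg_normed _)
    _ = (∫ z in positiveTimes, φ.normed volume (x - z)) * c := integral_mul_const _ _
    _ ≤ c := mul_le_of_le_one_left hc (integral_bump_le_one φ x)

theorem norm_mollify_le (φ : ContDiffBump (0 : SpaceTime)) {f : SpaceTime → F} {c : ℝ}
    (hc : 0 ≤ c) (hf : ∀ᵐ z ∂(volume.restrict positiveTimes), ‖f z‖ ≤ c) (x : SpaceTime) :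
    ‖mollify φ f x‖ ≤ c := by
  rw [mollify_apply]
  exact norm_integral_bump_smul_le φ hc hf x

theorem contDiff_mollify (φ : ContDiffBump (0 : SpaceTime)) {f : SpaceTime → F}
    (hf : MemLInfty f) : ContDiff ℝ ∞ (mollify φ f) :=
  φ.hasCompactSupport_normed.contDiff_convolution_right _ hf.locallyIntegrable_indicator
    φ.contDiff_normed

/-- Away from the boundary, mollification commutes with the weak derivative. -/
theorem fderiv_mollify (φ : ContDiffBump (0 : SpaceTime)) {f : SpaceTime → F}
    {g : SpaceTime → SpaceTime →L[ℝ] F} (hf : MemLInfty f) (hg : MemLInfty g)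
    (hfg : IsWeakDeriv f g) {x : SpaceTime} (hx : φ.rOut < x.1) :
    fderiv ℝ (mollify φ f) x = mollify φ g x := by
  have hψ : ContDiff ℝ ∞ (φ.normed volume) := φ.contDiff_normed
  have hψ1 : ContDiff ℝ 1 (φ.normed volume) := φ.contDiff_normed (n := 1)
  have hd := φ.hasCompactSupport_normed.hasFDerivAt_convolution_right (μ := volume)
    (ContinuousLinearMap.lsmul ℝ ℝ (E := F)).flip hf.locallyIntegrable_indicator hψ1 x
  refine ContinuousLinearMap.ext fun h => ?_
  have hdd : fderiv ℝ (mollify φ f) x = _ := hd.fderiv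
  rw [hdd, convolution_precompR_apply _ hf.locallyIntegrable_indicator
    (φ.hasCompactSupport_normed.fderiv (𝕜 := ℝ)) (hψ1.continuous_fderiv one_ne_zero),
    convolution_def, mollify_apply, ContinuousLinearMap.integral_apply
    (integrable_bump_smul φ hg x)]
  have hfd : ∀ z, fderiv ℝ (fun z => φ.normed volume (x - z)) z h
      = - fderiv ℝ (φ.normed volume) (x - z) h := by
    intro z
    have h1 : HasFDerivAt (fun z : SpaceTime => x - z) (-ContinuousLinearMap.id ℝ SpaceTime) z := by
      simpa using (hasFDerivAt_id z).const_sub x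
    have h2 := ((hψ.differentiable (by simp)) (x - z)).hasFDerivAt.comp z h1
    have h3 : fderiv ℝ (fun z => φ.normed volume (x - z)) z = _ := h2.fderiv
    rw [h3]
    simp
  have hcs : tsupport (fun z => φ.normed volume (x - z)) ⊆ Metric.closedBall x φ.rOut := by
    refine closure_minimal ?_ Metric.isClosed_closedBall
    intro z hz
    have hz' : x - z ∈ Function.support (φ.normed volume) := hz
    rw [φ.support_normed_eq, Metric.mem_ball, dist_zero_right] at hz'
    rw [Metric.mem_closedBall, dist_comm, dist_eq_norm]
    exact hz'.le
  have key := hfg.2.2 (fun z => φ.normed volume (x - z))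
    (hψ.comp (contDiff_const.sub contDiff_id))
    (HasCompactSupport.of_support_subset_isCompact (isCompact_closedBall x φ.rOut)
      ((subset_tsupport _).trans hcs))
    -- The hypothesis `φ.rOut < x.1` is what makes the reflected bump an admissible test function:
    -- its support stays at positive times.
    (hcs.trans fun z hz => by
      rw [mem_positiveTimes]
      rw [Metric.mem_closedBall, dist_eq_norm] at hz
      have h1 : |z.1 - x.1| ≤ φ.rOut := by
        have := norm_fst_le (z - x)
        rw [Prod.fst_sub, Real.norm_eq_abs] at this
        exact this.trans hz
      have := (abs_le.1 h1).1
      linarith) h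
  have e1 : ∫ z in positiveTimes, (fderiv ℝ (fun z => φ.normed volume (x - z)) z h) • f z
      = - ∫ z, ((ContinuousLinearMap.lsmul ℝ ℝ (E := F)).flip (positiveTimes.indicator f z))
          (fderiv ℝ (φ.normed volume) (x - z) h) := by
    rw [← integral_indicator isOpen_positiveTimes.measurableSet, ← integral_neg]
    congr 1
    ext z
    by_cases hz : z ∈ positiveTimes
    · simp only [indicator_of_mem hz, hfd]; simp
    · simp [hz]
  rw [e1, neg_inj] at key
  simpa using key

end Mollification

theorem IsWeakDeriv.weakDeriv {F : Type} [NormedAddCommGroup F] [NormedSpace ℝ F]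
    {f : SpaceTime → F} (h : ∃ g, IsWeakDeriv f g) : IsWeakDeriv f (weakDeriv f) := by
  rw [_root_.weakDeriv, dif_pos h]
  exact h.choose_spec

/-! ### Pointwise Lipschitz bounds and smooth approximations up to time zero. -/

section SmoothApproximation

open Filter Topology

/-- Regularity of a field on nonnegative times: bounded by `M`, Lipschitz with constant `L` in time
and with constant `K` in space. -/
structure IsLipField (E : SpaceTime → Plane) (M L K : ℝ) : Prop where
  bound : ∀ t x, 0 ≤ t → ‖E (t, x)‖ ≤ M
  lip_t : ∀ s t x, 0 ≤ s → 0 ≤ t → ‖E (s, x) - E (t, x)‖ ≤ L * |s - t|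
  lip_x : ∀ t x y, 0 ≤ t → ‖E (t, x) - E (t, y)‖ ≤ K * ‖x - y‖

/-- A smooth field `δ`-close to `E` on nonnegative times, with bounds on its first derivatives. -/
structure IsSmoothApprox (E e : SpaceTime → Plane) (L K δ : ℝ) : Prop where
  contDiff : ContDiff ℝ ∞ e
  close : ∀ z : SpaceTime, 0 ≤ z.1 → ‖E z - e z‖ ≤ δ
  bound_t : ∀ z : SpaceTime, 0 ≤ z.1 → ‖fderiv ℝ e z (1, 0)‖ ≤ L
  bound_x : ∀ z : SpaceTime, 0 ≤ z.1 → ∀ h, ‖fderiv ℝ e z (0, h)‖ ≤ K * ‖h‖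

theorem lInftyNorm_nonneg {F : Type} [NormedAddCommGroup F] (f : SpaceTime → F) :
    0 ≤ lInftyNorm f := ENNReal.toReal_nonneg

theorem Kx_nonneg (E : SpaceTime → Plane) : 0 ≤ Kx E := ENNReal.toReal_nonneg

/-- Going through the operator norm gives one null set valid for all directions `h` at once. -/
theorem ae_norm_weakDeriv_space_le {E : SpaceTime → Plane} (hE : MemLInfty (weakDeriv E)) :
    ∀ᵐ z ∂(volume.restrict positiveTimes), ∀ h : Plane,
      ‖weakDeriv E z (0, h)‖ ≤ Kx E * ‖h‖ := by
  have hm : MemLInfty fun z => (weakDeriv E z).comp (ContinuousLinearMap.inr ℝ ℝ Plane) := by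
    let T := (ContinuousLinearMap.compL ℝ Plane SpaceTime Plane).flip
      (ContinuousLinearMap.inr ℝ ℝ Plane)
    exact T.comp_memLp' hE
  filter_upwards [hm.ae_norm_le] with z hz h
  have := ((weakDeriv E z).comp (ContinuousLinearMap.inr ℝ ℝ Plane)).le_of_opNorm_le hz h
  simpa [Kx] using this

theorem mollify_clm_apply {F : Type} [NormedAddCommGroup F] [NormedSpace ℝ F]
    (φ : ContDiffBump (0 : SpaceTime)) {g : SpaceTime → SpaceTime →L[ℝ] F}
    (hg : MemLInfty g) (x h : SpaceTime) :
    mollify φ g x h = ∫ z in positiveTimes, φ.normed volume (x - z) • g z h := by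
  rw [mollify_apply, ContinuousLinearMap.integral_apply (integrable_bump_smul φ hg x)]
  rfl

theorem norm_mollify_sub_le {F : Type} [NormedAddCommGroup F] [NormedSpace ℝ F] [CompleteSpace F]
    (φ : ContDiffBump (0 : SpaceTime)) {f : SpaceTime → F} (hf : MemLInfty f) {x : SpaceTime}
    {c : F} {η : ℝ} (hη : 0 ≤ η) (hx : φ.rOut ≤ x.1)
    (h : ∀ w ∈ Metric.ball x φ.rOut, ‖f w - c‖ ≤ η) :
    ‖c - mollify φ f x‖ ≤ η := by
  rw [← dist_eq_norm, dist_comm, mollify, convolution_flip]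
  refine dist_convolution_le hη φ.support_normed_eq.subset φ.nonneg_normed φ.integral_normed
    hf.locallyIntegrable_indicator.aestronglyMeasurable ?_
  intro w hw
  have hwP : w ∈ positiveTimes := by
    rw [mem_positiveTimes]
    rw [Metric.mem_ball, dist_eq_norm] at hw
    have := (norm_fst_le (w - x)).trans_lt hw
    rw [Prod.fst_sub, Real.norm_eq_abs] at this
    have := (abs_lt.1 this).1
    linarith
  rw [indicator_of_mem hwP, dist_eq_norm]
  exact h w hw

/-- The bump function of radius `δ`. -/
noncomputable def bumpOfRadius (δ : ℝ) (hδ : 0 < δ) : ContDiffBump (0 : SpaceTime) :=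
  ⟨δ / 2, δ, by positivity, by linarith⟩

theorem lipschitz_of_fderiv_bounds {e : SpaceTime → Plane} (he : Differentiable ℝ e) {S : Set ℝ}
    (hS : Convex ℝ S) {L K : ℝ}
    (ht : ∀ z : SpaceTime, z.1 ∈ S → ‖fderiv ℝ e z (1, 0)‖ ≤ L)
    (hx : ∀ z : SpaceTime, z.1 ∈ S → ∀ h, ‖fderiv ℝ e z (0, h)‖ ≤ K * ‖h‖) (hK : 0 ≤ K) :
    (∀ s ∈ S, ∀ t ∈ S, ∀ x, ‖e (s, x) - e (t, x)‖ ≤ L * |s - t|) ∧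
    (∀ t ∈ S, ∀ x y, ‖e (t, x) - e (t, y)‖ ≤ K * ‖x - y‖) := by
  constructor
  · intro s hs t ht' x
    have h1 : ∀ r ∈ S, HasDerivWithinAt (fun r => e (r, x)) (fderiv ℝ e (r, x) (1, 0)) S r := by
      intro r _
      have : HasDerivAt (fun r : ℝ => (r, x)) ((1 : ℝ), (0 : Plane)) r :=
        (hasDerivAt_id r).prodMk (hasDerivAt_const r x)
      exact ((he (r, x)).hasFDerivAt.comp_hasDerivAt r this).hasDerivWithinAt
    simpa using hS.norm_image_sub_le_of_norm_hasDerivWithin_le h1 (fun r hr => ht (r, x) hr) ht' hs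
  · intro t ht' x y
    have h1 : ∀ w ∈ (univ : Set Plane), HasFDerivWithinAt (fun w => e (t, w))
        ((fderiv ℝ e (t, w)).comp (ContinuousLinearMap.inr ℝ ℝ Plane)) univ w := by
      intro w _
      exact ((he (t, w)).hasFDerivAt.comp w (hasFDerivAt_prodMk_right t w)).hasFDerivWithinAt
    refine convex_univ.norm_image_sub_le_of_norm_hasFDerivWithin_le h1 (fun w _ => ?_)
      (mem_univ y) (mem_univ x)
    refine ContinuousLinearMap.opNorm_le_bound _ hK fun h => ?_
    simpa using hx (t, w) ht' h

variable {E : SpaceTime → Plane}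

theorem tendsto_time_shift (hE : ContinuousOn E (Ici 0 ×ˢ univ)) {t : ℝ} (ht : 0 ≤ t) (x : Plane) :
    Tendsto (fun τ => E (t + τ, x)) (𝓝[>] 0) (𝓝 (E (t, x))) := by
  have h1 : Tendsto E (𝓝[Ici 0 ×ˢ univ] (t, x)) (𝓝 (E (t, x))) := hE (t, x) (by simpa using ht)
  refine h1.comp (tendsto_nhdsWithin_iff.2 ⟨?_, ?_⟩)
  · have : Continuous fun τ : ℝ => (t + τ, x) := by fun_prop
    have h2 := this.tendsto 0
    simp only [add_zero] at h2
    exact h2.mono_left nhdsWithin_le_nhds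
  · filter_upwards [self_mem_nhdsWithin] with τ hτ
    have : 0 < τ := hτ
    simp; linarith

theorem fderiv_mollify_bounds (hE : MemLInfty E) (hd : ∃ g, IsWeakDeriv E g)
    (hD : MemLInfty (weakDeriv E)) (φ : ContDiffBump (0 : SpaceTime)) {z : SpaceTime}
    (hz : φ.rOut < z.1) :
    ‖fderiv ℝ (mollify φ E) z (1, 0)‖ ≤ lInftyNorm (weakDeriv E) ∧
      ∀ h, ‖fderiv ℝ (mollify φ E) z (0, h)‖ ≤ Kx E * ‖h‖ := by
  rw [fderiv_mollify φ hE hD (IsWeakDeriv.weakDeriv hd) hz]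
  refine ⟨?_, fun h => ?_⟩ <;> rw [mollify_clm_apply φ hD]
  · refine norm_integral_bump_smul_le φ (lInftyNorm_nonneg _) ?_ z
    filter_upwards [hD.ae_norm_le] with w hw
    simpa using (weakDeriv E w).le_of_opNorm_le hw (1, 0)
  · refine norm_integral_bump_smul_le φ (mul_nonneg (Kx_nonneg E) (norm_nonneg h)) ?_ z
    filter_upwards [ae_norm_weakDeriv_space_le hD] with w hw using hw h

theorem exists_radius_mollify_close (hE : ContinuousOn E (Ici 0 ×ˢ univ)) (hE' : MemLInfty E)
    {z : SpaceTime} (hz : 0 < z.1) {η : ℝ} (hη : 0 < η) :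
    ∀ᶠ r in 𝓝[>] (0 : ℝ), ∀ hr : 0 < r, ‖E z - mollify (bumpOfRadius r hr) E z‖ ≤ η := by
  have hcont : ContinuousAt E z := hE.continuousAt (by
    refine mem_of_superset (isOpen_positiveTimes.mem_nhds (mem_positiveTimes.2 hz)) ?_
    exact prod_mono Ioi_subset_Ici_self subset_rfl)
  obtain ⟨ρ, hρ, hball⟩ := Metric.continuousAt_iff.1 hcont η hη
  filter_upwards [Ioo_mem_nhdsGT (lt_min hρ hz)] with r hr hr0
  refine norm_mollify_sub_le _ hE' hη.le (hr.2.le.trans (min_le_right _ _)) fun w hw => ?_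
  rw [← dist_eq_norm]
  have hw' : dist w z < r := hw
  exact (hball (hw'.trans (hr.2.trans_le (min_le_left _ _)))).le

/-- At positive times the bounds hold for mollifications and pass to the limit by continuity of `E`.
Time zero is then reached by shifting time by `τ` and letting `τ` decrease to zero. -/
theorem IsSobolevField.isLipField (hE : IsSobolevField 1 E) :
    IsLipField E (lInftyNorm E) (lInftyNorm (weakDeriv E)) (Kx E) := by
  obtain ⟨hc, hE0, hd, hD⟩ := hE
  have hD : MemLInfty (weakDeriv E) := hD
  have hb0 : ∀ z : SpaceTime, 0 < z.1 → ‖E z‖ ≤ lInftyNorm E := by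
    intro z hz
    refine le_of_forall_pos_le_add fun η hη => ?_
    obtain ⟨r, h1, hr⟩ := ((exists_radius_mollify_close hc hE0 hz hη).and
      self_mem_nhdsWithin).exists
    have hr : 0 < r := hr
    have h2 := norm_mollify_le (bumpOfRadius r hr) (lInftyNorm_nonneg E) hE0.ae_norm_le z
    have h3 := norm_le_norm_add_norm_sub' (E z) (mollify (bumpOfRadius r hr) E z)
    linarith [h1 hr]
  have hlip : ∀ z w : SpaceTime, 0 < z.1 → 0 < w.1 → ∀ c : ℝ,
      (∀ r (hr : 0 < r), r < z.1 → r < w.1 → ‖mollify (bumpOfRadius r hr) E z -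
        mollify (bumpOfRadius r hr) E w‖ ≤ c) → ‖E z - E w‖ ≤ c := by
    intro z w hz hw c hm
    refine le_of_forall_pos_le_add fun η hη => ?_
    obtain ⟨r, ⟨h1, h2⟩, h3, hr⟩ := (((exists_radius_mollify_close hc hE0 hz (half_pos hη)).and
      (exists_radius_mollify_close hc hE0 hw (half_pos hη))).and
      (Ioo_mem_nhdsGT (lt_min hz hw))).exists
    have h4 := hm r h3 (hr.trans_le (min_le_left _ _)) (hr.trans_le (min_le_right _ _))
    have h5 : E z - E w = (E z - mollify (bumpOfRadius r h3) E z) +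
      (mollify (bumpOfRadius r h3) E z - mollify (bumpOfRadius r h3) E w) -
      (E w - mollify (bumpOfRadius r h3) E w) := by abel
    rw [h5]
    refine (norm_sub_le _ _).trans ?_
    have := norm_add_le (E z - mollify (bumpOfRadius r h3) E z)
      (mollify (bumpOfRadius r h3) E z - mollify (bumpOfRadius r h3) E w)
    linarith [h1 h3, h2 h3]
  -- Mollification of radius `r` has controlled derivatives only at times beyond `r`, a convex set,
  -- so the mean value inequality applies there.
  have hL : ∀ (r : ℝ) (hr : 0 < r), _ := fun r hr =>
    lipschitz_of_fderiv_bounds ((contDiff_mollify (bumpOfRadius r hr) hE0).differentiable (by simp))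
      (convex_Ioi r)
      (fun z hz => (fderiv_mollify_bounds hE0 hd hD (bumpOfRadius r hr) hz).1)
      (fun z hz => (fderiv_mollify_bounds hE0 hd hD (bumpOfRadius r hr) hz).2) (Kx_nonneg E)
  refine ⟨fun t x ht => ?_, fun s t x hs ht => ?_, fun t x y ht => ?_⟩
  · refine le_of_tendsto (tendsto_time_shift hc ht x).norm ?_
    filter_upwards [self_mem_nhdsWithin] with τ hτ
    exact hb0 _ (add_pos_of_nonneg_of_pos ht hτ)
  · refine le_of_tendsto ((tendsto_time_shift hc hs x).sub (tendsto_time_shift hc ht x)).norm ?_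
    filter_upwards [self_mem_nhdsWithin] with τ hτ
    refine hlip _ _ (add_pos_of_nonneg_of_pos hs hτ) (add_pos_of_nonneg_of_pos ht hτ) _ ?_
    intro r hr h1 h2
    simpa using (hL r hr).1 _ h1 _ h2 x
  · refine le_of_tendsto ((tendsto_time_shift hc ht x).sub (tendsto_time_shift hc ht y)).norm ?_
    filter_upwards [self_mem_nhdsWithin] with τ hτ
    refine hlip _ _ (add_pos_of_nonneg_of_pos ht hτ) (add_pos_of_nonneg_of_pos ht hτ) _ ?_
    intro r hr h1 h2
    exact (hL r hr).2 _ h1 x y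

/-- Mollification with radius `r`, shifted by `2 r` in time so as to stay away from the boundary. -/
noncomputable def shiftedMollify (r : ℝ) (hr : 0 < r) (E : SpaceTime → Plane) :
    SpaceTime → Plane :=
  fun z => mollify (bumpOfRadius r hr) E (z + (2 * r, 0))

/-- After the shift by `2 r`, balls of radius `r` centered at shifted nonnegative times lie at
positive times. Points averaged there are within `3 r` in time and `r` in space of the original
point, whence `3 L + K`. -/
theorem isSmoothApprox_shiftedMollify (hE : IsSobolevField 1 E) {r δ : ℝ} (hr : 0 < r)
    (hδ : (3 * lInftyNorm (weakDeriv E) + Kx E) * r ≤ δ) :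
    IsSmoothApprox E (shiftedMollify r hr E) (lInftyNorm (weakDeriv E)) (Kx E) δ := by
  have hlip := hE.isLipField
  obtain ⟨hc, hE0, hd, hD⟩ := hE
  have hD : MemLInfty (weakDeriv E) := hD
  have hL0 := lInftyNorm_nonneg (weakDeriv E)
  have hK0 := Kx_nonneg E
  have hfd : ∀ z, fderiv ℝ (shiftedMollify r hr E) z =
      fderiv ℝ (mollify (bumpOfRadius r hr) E) (z + (2 * r, 0)) := fun z =>
    fderiv_comp_add_right _
  have hpos : ∀ z : SpaceTime, 0 ≤ z.1 → (bumpOfRadius r hr).rOut < (z + (2 * r, 0)).1 := by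
    intro z hz
    simp only [bumpOfRadius, Prod.fst_add]
    linarith
  refine ⟨(contDiff_mollify _ hE0).comp (contDiff_id.add contDiff_const), fun z hz => ?_,
    fun z hz => ?_, fun z hz => ?_⟩
  · refine norm_mollify_sub_le _ hE0 ((by positivity : 0 ≤ _ * r).trans hδ) (hpos z hz).le
      fun w hw => ?_
    have hw' : ‖w - (z + (2 * r, 0))‖ < r := by rw [← dist_eq_norm]; exact hw
    have h1 : |w.1 - (z.1 + 2 * r)| < r := (norm_fst_le (w - (z + (2 * r, 0)))).trans_lt hw'
    have h2 : ‖w.2 - z.2‖ < r := by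
      simpa using (norm_snd_le (w - (z + (2 * r, 0)))).trans_lt hw'
    rw [abs_lt] at h1
    have hw1 : 0 ≤ w.1 := by linarith
    have h3 := hlip.lip_t w.1 z.1 w.2 hw1 hz
    have h4 := hlip.lip_x z.1 w.2 z.2 hz
    have h5 : |w.1 - z.1| ≤ 3 * r := by rw [abs_le]; constructor <;> linarith
    calc ‖E w - E z‖ = ‖(E (w.1, w.2) - E (z.1, w.2)) + (E (z.1, w.2) - E (z.1, z.2))‖ := by simp
      _ ≤ lInftyNorm (weakDeriv E) * (3 * r) + Kx E * r := by
        refine (norm_add_le _ _).trans (add_le_add (h3.trans ?_) (h4.trans ?_))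
        · gcongr
        · gcongr
      _ ≤ δ := by linarith
  · rw [hfd]
    exact (fderiv_mollify_bounds hE0 hd hD _ (hpos z hz)).1
  · rw [hfd]
    exact (fderiv_mollify_bounds hE0 hd hD _ (hpos z hz)).2

theorem IsSobolevField.exists_isSmoothApprox (hE : IsSobolevField 1 E) {δ : ℝ} (hδ : 0 < δ) :
    ∃ e, IsSmoothApprox E e (lInftyNorm (weakDeriv E)) (Kx E) δ := by
  have hL0 := lInftyNorm_nonneg (weakDeriv E)
  have hK0 := Kx_nonneg E
  have hr : 0 < δ / (3 * lInftyNorm (weakDeriv E) + Kx E + 1) := by positivity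
  refine ⟨_, isSmoothApprox_shiftedMollify hE hr ?_⟩
  rw [mul_div_assoc', div_le_iff₀ (by positivity)]
  nlinarith

theorem IsSobolevField.one_of_two (hE : IsSobolevField 2 E) : IsSobolevField 1 E :=
  ⟨hE.1, hE.2.1, hE.2.2.1, hE.2.2.2.1⟩

theorem IsSobolevField.exists_isSmoothApprox_two (hE : IsSobolevField 2 E) {δ : ℝ} (hδ : 0 < δ) :
    ∃ e, IsSmoothApprox E e (lInftyNorm (weakDeriv E)) (Kx E) δ ∧
      ∀ z : SpaceTime, 0 ≤ z.1 →
        ‖fderiv ℝ (fderiv ℝ e) z‖ ≤ lInftyNorm (weakDeriv (weakDeriv E)) := by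
  have hL0 := lInftyNorm_nonneg (weakDeriv E)
  have hK0 := Kx_nonneg E
  have hr : 0 < δ / (3 * lInftyNorm (weakDeriv E) + Kx E + 1) := by positivity
  refine ⟨_, isSmoothApprox_shiftedMollify hE.one_of_two hr ?_, fun z hz => ?_⟩
  · rw [mul_div_assoc', div_le_iff₀ (by positivity)]
    nlinarith
  set r := δ / (3 * lInftyNorm (weakDeriv E) + Kx E + 1)
  obtain ⟨hc, hE0, hd, hD, hdd, hDD⟩ := hE
  have hDD : MemLInfty (weakDeriv (weakDeriv E)) := hDD
  have h1 : fderiv ℝ (shiftedMollify r hr E) =ᶠ[𝓝 z]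
      fun z => mollify (bumpOfRadius r hr) (weakDeriv E) (z + (2 * r, 0)) := by
    -- The shift `2 r` exceeds the radius by `r`, so the formula for the first derivative persists
    -- on a full neighborhood even of a point at time zero and may be differentiated again.
    have ho : IsOpen {w : SpaceTime | -r < w.1} := isOpen_lt continuous_const continuous_fst
    filter_upwards [ho.mem_nhds (show -r < z.1 by linarith)] with w hw
    have hw : -r < w.1 := hw
    have h2 : fderiv ℝ (shiftedMollify r hr E) w =
      fderiv ℝ (mollify (bumpOfRadius r hr) E) (w + (2 * r, 0)) := fderiv_comp_add_right _
    rw [h2, fderiv_mollify _ hE0 hD (IsWeakDeriv.weakDeriv hd)]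
    simp only [bumpOfRadius, Prod.fst_add]
    linarith
  rw [h1.fderiv_eq, fderiv_comp_add_right, fderiv_mollify _ hD hDD (IsWeakDeriv.weakDeriv hdd)]
  · exact norm_mollify_le _ (lInftyNorm_nonneg _) hDD.ae_norm_le _
  · simp only [bumpOfRadius, Prod.fst_add]
    linarith

end SmoothApproximation

/-! ### Algebra of the rotation by a right angle. -/

section Rotation

theorem perp_add (v w : Plane) : perp (v + w) = perp v + perp w := by
  ext i; fin_cases i <;> simp [perp]; ring

theorem perp_smul (c : ℝ) (v : Plane) : perp (c • v) = c • perp v := by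
  ext i; fin_cases i <;> simp [perp]

/-- The rotation `perp` as a continuous linear map. -/
noncomputable def perpCLM : Plane →L[ℝ] Plane :=
  LinearMap.toContinuousLinearMap
    { toFun := perp, map_add' := perp_add, map_smul' := perp_smul }

@[simp] theorem perpCLM_apply (v : Plane) : perpCLM v = perp v := rfl

theorem perp_neg (v : Plane) : perp (-v) = -perp v := map_neg perpCLM v

theorem perp_sub (v w : Plane) : perp (v - w) = perp v - perp w := map_sub perpCLM v w

theorem perp_perp (v : Plane) : perp (perp v) = -v := by
  ext i; fin_cases i <;> simp [perp]

theorem norm_sq_eq (v : Plane) : ‖v‖ ^ 2 = v 0 ^ 2 + v 1 ^ 2 := by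
  rw [EuclideanSpace.norm_sq_eq]; simp

theorem norm_perp (v : Plane) : ‖perp v‖ = ‖v‖ := by
  refine (sq_eq_sq₀ (norm_nonneg _) (norm_nonneg _)).1 ?_
  rw [norm_sq_eq, norm_sq_eq]; simp [perp]; ring

theorem norm_smul_add_smul_perp_sq (a b : ℝ) (v : Plane) :
    ‖a • v + b • perp v‖ ^ 2 = (a ^ 2 + b ^ 2) * ‖v‖ ^ 2 := by
  rw [norm_sq_eq, norm_sq_eq]; simp [perp]; ring

/-- As `perp v` is orthogonal to `v` and of equal length, the squared norm is multiplied by `1 +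
c²`. This is the unconditional stability of the implicit step, whatever the ratio `Δt / ε²`. -/
theorem norm_le_norm_add_smul_perp (c : ℝ) (v : Plane) : ‖v‖ ≤ ‖v + c • perp v‖ := by
  refine (sq_le_sq₀ (norm_nonneg _) (norm_nonneg _)).1 ?_
  have := norm_smul_add_smul_perp_sq 1 c v
  rw [one_smul] at this
  rw [this]
  nlinarith [sq_nonneg c, sq_nonneg ‖v‖]

theorem norm_cos_smul_add_sin_smul_perp (θ : ℝ) (v : Plane) :
    ‖Real.cos θ • v + Real.sin θ • perp v‖ = ‖v‖ := by
  refine (sq_eq_sq₀ (norm_nonneg _) (norm_nonneg _)).1 ?_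
  rw [norm_smul_add_smul_perp_sq, Real.cos_sq_add_sin_sq, one_mul]

theorem add_smul_perp_injective {c : ℝ} {v w : Plane} (h : v + c • perp v = w + c • perp w) :
    v = w := by
  have h1 : (v - w) + c • perp (v - w) = 0 := by
    rw [perp_sub, smul_sub, ← sub_eq_zero.2 h]; abel
  have h2 := norm_le_norm_add_smul_perp c (v - w)
  rw [h1, norm_zero] at h2
  exact sub_eq_zero.1 (norm_le_zero_iff.1 h2)

/-- With `J² = -1` one has `(1 + cJ)(1 - cJ) = 1 + c²`. -/
theorem add_smul_perp_inverse (c : ℝ) (b : Plane) :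
    (1 + c ^ 2)⁻¹ • (b - c • perp b) + c • perp ((1 + c ^ 2)⁻¹ • (b - c • perp b)) = b := by
  have : (1 + c ^ 2) ≠ 0 := by positivity
  rw [perp_smul, perp_sub, perp_smul, perp_perp]
  match_scalars <;> field_simp
  ring

end Rotation

/-! ### Resolved form and unique solvability of the scheme. -/

section Scheme

variable {E : SpaceTime → Plane} {ε τ : ℝ} {x₀ v₀ : Plane} {y v : ℕ → Plane}

theorem scheme_step_v_iff (hε : 0 < ε) (hτ : 0 < τ) {v w F : Plane} :
    τ⁻¹ • (w - v) = ε⁻¹ • F - (ε ^ 2)⁻¹ • perp w ↔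
      w + (τ / ε ^ 2) • perp w = v + (τ / ε) • F := by
  constructor
  · intro h
    have h1 : w - v = τ • (ε⁻¹ • F - (ε ^ 2)⁻¹ • perp w) := by rw [← h, smul_inv_smul₀ hτ.ne']
    linear_combination (norm := (match_scalars <;> field_simp <;> ring)) h1
  · intro h
    rw [inv_smul_eq_iff₀ hτ.ne']
    linear_combination (norm := (match_scalars <;> field_simp <;> ring)) h

theorem scheme_step_y_iff (hτ : 0 < τ) {y w F : Plane} :
    τ⁻¹ • (w - y) = -perp F ↔ w = y - τ • perp F := by
  rw [inv_smul_eq_iff₀ hτ.ne', sub_eq_iff_eq_add, smul_neg, neg_add_eq_sub]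

theorem IsScheme.v_succ (h : IsScheme E ε τ x₀ v₀ y v) (hε : 0 < ε) (hτ : 0 < τ) (n : ℕ) :
    v (n + 1) + (τ / ε ^ 2) • perp (v (n + 1)) =
      v n + (τ / ε) • E (n * τ, y n + ε • perp (v n)) :=
  (scheme_step_v_iff hε hτ).1 (h.step_v n)

theorem IsScheme.y_succ (h : IsScheme E ε τ x₀ v₀ y v) (hτ : 0 < τ) (n : ℕ) :
    y (n + 1) = y n - τ • perp (E (n * τ, y n + ε • perp (v (n + 1)))) :=
  (scheme_step_y_iff hτ).1 (h.step_y n)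

/-- The scheme in resolved form, iterated from `(y⁰, v⁰)`. -/
noncomputable def schemeIterate (E : SpaceTime → Plane) (ε τ : ℝ) (x₀ v₀ : Plane) :
    ℕ → Plane × Plane
  | 0 => (x₀ - ε • perp v₀, v₀)
  | n + 1 =>
    let y := (schemeIterate E ε τ x₀ v₀ n).1
    let v := (schemeIterate E ε τ x₀ v₀ n).2
    let b := v + (τ / ε) • E (n * τ, y + ε • perp v)
    let w := (1 + (τ / ε ^ 2) ^ 2)⁻¹ • (b - (τ / ε ^ 2) • perp b)
    (y - τ • perp (E (n * τ, y + ε • perp w)), w)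

theorem isScheme_schemeIterate (E : SpaceTime → Plane) (hε : 0 < ε) (hτ : 0 < τ)
    (x₀ v₀ : Plane) :
    IsScheme E ε τ x₀ v₀ (fun n => (schemeIterate E ε τ x₀ v₀ n).1)
      (fun n => (schemeIterate E ε τ x₀ v₀ n).2) where
  init_y := rfl
  init_v := rfl
  step_v _ := (scheme_step_v_iff hε hτ).2 (add_smul_perp_inverse _ _)
  step_y _ := (scheme_step_y_iff hτ).2 rfl

theorem IsScheme.unique (hε : 0 < ε) (hτ : 0 < τ) (h : IsScheme E ε τ x₀ v₀ y v)
    {y' v' : ℕ → Plane} (h' : IsScheme E ε τ x₀ v₀ y' v') : y = y' ∧ v = v' := by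
  have key : ∀ n, y n = y' n ∧ v n = v' n := by
    intro n
    induction n with
    | zero => exact ⟨h.init_y.trans h'.init_y.symm, h.init_v.trans h'.init_v.symm⟩
    | succ n ih =>
      have hv : v (n + 1) = v' (n + 1) := by
        refine add_smul_perp_injective (c := τ / ε ^ 2) ?_
        rw [h.v_succ hε hτ, h'.v_succ hε hτ, ih.1, ih.2]
      refine ⟨?_, hv⟩
      rw [h.y_succ hτ, h'.y_succ hτ, ih.1, hv]
  exact ⟨funext fun n => (key n).1, funext fun n => (key n).2⟩

theorem existsUnique_isScheme (E : SpaceTime → Plane) (hε : 0 < ε) (hτ : 0 < τ)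
    (x₀ v₀ : Plane) :
    ∃! p : (ℕ → Plane) × (ℕ → Plane), IsScheme E ε τ x₀ v₀ p.1 p.2 := by
  refine ⟨(_, _), isScheme_schemeIterate E hε hτ x₀ v₀, fun p hp => ?_⟩
  obtain ⟨h1, h2⟩ := hp.unique hε hτ (isScheme_schemeIterate E hε hτ x₀ v₀)
  exact Prod.ext h1 h2

end Scheme

/-! ### Velocity bounds independent of the stiffness. -/

section VelocityBounds

/-- The source may grow at the same exponential rate as the homogeneous recursion: the resonance
costs only the factor `n`, not a second exponential. Sources built from exponentially growing
velocities are absorbed this way. -/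
theorem discrete_gronwall_exp {s : ℕ → ℝ} {q D : ℝ} (hq : 0 ≤ q) (hD : 0 ≤ D) (h0 : 0 ≤ s 0) (n : ℕ)
    (h : ∀ k < n, s (k + 1) ≤ (1 + q) * s k + D * Real.exp (q * (k + 1))) :
    s n ≤ (s 0 + n * D) * Real.exp (q * n) := by
  induction n with
  | zero => simp
  | succ n ih =>
    have ih := ih fun k hk => h k (hk.trans n.lt_succ_self)
    have h1 : (1 + q) * Real.exp (q * n) ≤ Real.exp (q * (n + 1)) := by
      rw [mul_add, mul_one, add_comm (q * n) q, Real.exp_add]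
      gcongr
      linarith [Real.add_one_le_exp q]
    calc s (n + 1) ≤ (1 + q) * s n + D * Real.exp (q * (n + 1)) := h n n.lt_succ_self
      _ ≤ (1 + q) * ((s 0 + n * D) * Real.exp (q * n)) + D * Real.exp (q * (n + 1)) := by gcongr
      _ = (s 0 + n * D) * ((1 + q) * Real.exp (q * n)) + D * Real.exp (q * (n + 1)) := by ring
      _ ≤ (s 0 + n * D) * Real.exp (q * (n + 1)) + D * Real.exp (q * (n + 1)) := by gcongr
      _ = (s 0 + (n + 1 : ℕ) * D) * Real.exp (q * (n + 1 : ℕ)) := by push_cast; ring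

theorem gronwallBound_le {δ K ε t : ℝ} (hK : 0 ≤ K) (hε : 0 ≤ ε) :
    gronwallBound δ K ε t ≤ Real.exp (K * t) * (δ + t * ε) := by
  rcases hK.eq_or_lt with rfl | hK
  · rw [gronwallBound_K0]; simp; linarith
  · rw [gronwallBound_of_K_ne_0 hK.ne']
    have h1 : Real.exp (K * t) - 1 ≤ K * t * Real.exp (K * t) := by
      have h2 := Real.add_one_le_exp (-(K * t))
      -- Multiplying `1 - K t ≤ exp (-K t)` by `exp (K t)` removes the division by `K`.
      have h3 : Real.exp (-(K * t)) * Real.exp (K * t) = 1 := by rw [← Real.exp_add]; simp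
      nlinarith [Real.exp_pos (K * t)]
    have h4 : ε / K * (Real.exp (K * t) - 1) ≤ ε / K * (K * t * Real.exp (K * t)) := by gcongr
    have h5 : ε / K * (K * t * Real.exp (K * t)) = ε * t * Real.exp (K * t) := by
      field_simp
    linarith

/-- Bound on the velocities at times up to `t`, uniform with respect to the stiffness; `b` is the
norm of the initial velocity. -/
noncomputable def velocityBound (M L K ε b t : ℝ) : ℝ :=
  (4 + 2 * M + L + K * (3 * M + 1)) * (1 + t) * Real.exp (K * t) * (b + ε)

theorem velocityBound_mono {M L K ε b s t : ℝ} (hM : 0 ≤ M) (hL : 0 ≤ L) (hK : 0 ≤ K)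
    (hε : 0 ≤ ε) (hb : 0 ≤ b) (hs : 0 ≤ s) (hst : s ≤ t) :
    velocityBound M L K ε b s ≤ velocityBound M L K ε b t := by
  unfold velocityBound
  have ht := hs.trans hst
  gcongr

/-- The thresholds on `c` and `d` cover both applications: `2 (M + 1)` and `1 + L + K (M + 1)` for
the flow, `2 M` and `L + 3 K M` for the scheme. -/
theorem le_velocityBound {M L K ε b t c d : ℝ} (hM : 0 ≤ M) (hL : 0 ≤ L) (hK : 0 ≤ K)
    (hε : 0 ≤ ε) (hb : 0 ≤ b) (ht : 0 ≤ t) (hc : c ≤ 2 + 2 * M)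
    (hd : d ≤ 1 + L + K * (3 * M + 1)) :
    Real.exp (K * t) * (b + ε * c + t * (ε * d)) ≤ velocityBound M L K ε b t := by
  have hA : 1 ≤ 4 + 2 * M + L + K * (3 * M + 1) := by
    have : 0 ≤ K * (3 * M + 1) := by positivity
    linarith
  have h1 : b + ε * c + t * (ε * d) ≤
      (4 + 2 * M + L + K * (3 * M + 1)) * (1 + t) * (b + ε) := by
    have h2 : b ≤ (4 + 2 * M + L + K * (3 * M + 1)) * b := le_mul_of_one_le_left hb hA
    have h3 : ε * c ≤ ε * (4 + 2 * M + L + K * (3 * M + 1)) := by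
      gcongr
      have : 0 ≤ K * (3 * M + 1) := by positivity
      linarith
    have h4 : t * (ε * d) ≤ t * (ε * (4 + 2 * M + L + K * (3 * M + 1))) := by
      gcongr
      linarith
    have h5 : 0 ≤ (4 + 2 * M + L + K * (3 * M + 1)) * t * b := by positivity
    linarith
  calc _ ≤ Real.exp (K * t) * ((4 + 2 * M + L + K * (3 * M + 1)) * (1 + t) * (b + ε)) := by gcongr
    _ = _ := by rw [velocityBound]; ring

variable {E : SpaceTime → Plane} {M L K ε τ : ℝ} {x₀ v₀ : Plane}

theorem IsLipField.nonneg (hE : IsLipField E M L K) : 0 ≤ M ∧ 0 ≤ L ∧ 0 ≤ K := by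
  refine ⟨(norm_nonneg _).trans (hE.bound 0 0 le_rfl), ?_, ?_⟩
  · have := hE.lip_t 0 1 0 le_rfl zero_le_one
    simp only [zero_sub, abs_neg, abs_one, mul_one] at this
    exact (norm_nonneg _).trans this
  · have := hE.lip_x 0 (EuclideanSpace.single 0 1) 0 le_rfl
    simp only [sub_zero, PiLp.norm_single, norm_one, mul_one] at this
    exact (norm_nonneg _).trans this

theorem IsCharacteristic.norm_v_le (hE : IsLipField E M L K)
    (happ : ∀ δ > 0, ∃ e, IsSmoothApprox E e L K δ) (hε : 0 < ε) {x v : ℝ → Plane}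
    (h : IsCharacteristic E ε x₀ v₀ x v) {t : ℝ} (ht : 0 ≤ t) :
    ‖v t‖ ≤ velocityBound M L K ε ‖v₀‖ t := by
  obtain ⟨hM, hL, hK⟩ := hE.nonneg
  -- Accuracy `ε²` makes the residual `ε⁻¹ (E - e)` of size `ε`; accuracy `1` keeps `e` bounded by
  -- `M + 1`.
  obtain ⟨e, he⟩ := happ (min 1 (ε ^ 2)) (by positivity)
  have he1 : ∀ s x, 0 ≤ s → ‖e (s, x)‖ ≤ M + 1 := by
    intro s x hs
    have h1 := (he.close (s, x) hs).trans (min_le_left _ _)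
    have h2 := norm_le_norm_add_norm_sub (E (s, x)) (e (s, x))
    linarith [hE.bound s x hs]
  have hed : Differentiable ℝ e := he.contDiff.differentiable (by simp)
  -- Subtracting the drift velocity removes the source of size `ε⁻¹`. The new source `d`
  -- differentiates the field along `x' = v / ε`, and its factor `ε` cancels that `ε⁻¹`.
  let u : ℝ → Plane := fun s => v s + ε • perpCLM (e (s, x s))
  let d : ℝ → Plane := fun s =>
    ε⁻¹ • (E (s, x s) - e (s, x s)) + ε • perp (fderiv ℝ e (s, x s) (1, ε⁻¹ • v s))
  -- In the frame rotating at frequency `ε⁻²` the stiff term disappears while norms are unchanged,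
  -- so Gronwall sees only `d`.
  let f : ℝ → Plane := fun s => Real.cos (s / ε ^ 2) • u s + Real.sin (s / ε ^ 2) • perpCLM (u s)
  have hu : ∀ s, 0 ≤ s → HasDerivWithinAt u (d s - (ε ^ 2)⁻¹ • perp (u s)) (Ici 0) s := by
    intro s hs
    have h1 : HasDerivWithinAt (fun s => e (s, x s)) (fderiv ℝ e (s, x s) (1, ε⁻¹ • v s))
        (Ici 0) s :=
      (hed (s, x s)).hasFDerivAt.comp_hasDerivWithinAt s
        ((hasDerivWithinAt_id s _).prodMk (h.deriv_x s hs))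
    have h2 := (h.deriv_v s hs).add
      ((perpCLM.hasFDerivAt.comp_hasDerivWithinAt s h1).const_smul ε)
    refine h2.congr_deriv ?_
    simp only [d, u, perpCLM_apply, perp_add, perp_smul, perp_perp]
    match_scalars <;> field_simp
    ring
  have hf : ∀ s, 0 ≤ s → HasDerivWithinAt f
      (Real.cos (s / ε ^ 2) • d s + Real.sin (s / ε ^ 2) • perp (d s)) (Ici 0) s := by
    intro s hs
    have hθ : HasDerivWithinAt (fun s => s / ε ^ 2) (1 / ε ^ 2) (Ici 0) s :=
      (hasDerivWithinAt_id s _).div_const _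
    have h1 := (hθ.cos.smul (hu s hs)).add
      (hθ.sin.smul (perpCLM.hasFDerivAt.comp_hasDerivWithinAt s (hu s hs)))
    refine h1.congr_deriv ?_
    simp only [perpCLM_apply, Function.comp_apply, perp_sub, perp_smul, perp_perp]
    match_scalars <;> field_simp <;> ring
  have hfn : ∀ s, ‖f s‖ = ‖u s‖ := fun s => norm_cos_smul_add_sin_smul_perp _ _
  have hvu : ∀ s, 0 ≤ s → ‖v s‖ ≤ ‖u s‖ + ε * (M + 1) := by
    intro s hs
    have h1 : v s = u s - ε • perp (e (s, x s)) := by simp [u]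
    rw [h1]
    refine (norm_sub_le _ _).trans ?_
    rw [norm_smul, norm_perp, Real.norm_of_nonneg hε.le]
    gcongr
    exact he1 s _ hs
  have hd : ∀ s, 0 ≤ s → ‖d s‖ ≤ K * ‖u s‖ + ε * (1 + L + K * (M + 1)) := by
    intro s hs
    have h1 : ‖ε⁻¹ • (E (s, x s) - e (s, x s))‖ ≤ ε := by
      rw [norm_smul, Real.norm_of_nonneg (by positivity), inv_mul_le_iff₀ hε]
      calc _ ≤ ε ^ 2 := (he.close (s, x s) hs).trans (min_le_right _ _)
        _ = ε * ε := sq ε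
    have h2 : ‖fderiv ℝ e (s, x s) (1, ε⁻¹ • v s)‖ ≤ L + K * (ε⁻¹ * ‖v s‖) := by
      have h3 : ((1 : ℝ), ε⁻¹ • v s) = (1, 0) + (0, ε⁻¹ • v s) := by simp
      rw [h3, map_add]
      refine (norm_add_le _ _).trans (add_le_add (he.bound_t _ hs)
        ((he.bound_x _ hs _).trans_eq ?_))
      rw [norm_smul, Real.norm_of_nonneg (by positivity)]
    calc ‖d s‖ ≤ ε + ε * (L + K * (ε⁻¹ * ‖v s‖)) := by
          refine (norm_add_le _ _).trans (add_le_add h1 ?_)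
          rw [norm_smul, norm_perp, Real.norm_of_nonneg hε.le]
          gcongr
      _ = ε + ε * L + K * ‖v s‖ := by field_simp; ring
      _ ≤ ε + ε * L + K * (‖u s‖ + ε * (M + 1)) := by gcongr; exact hvu s hs
      _ = _ := by ring
  have h0 : ‖f 0‖ ≤ ‖v₀‖ + ε * (M + 1) := by
    rw [hfn]
    refine (norm_add_le _ _).trans ?_
    rw [h.init_v, norm_smul, perpCLM_apply, norm_perp, Real.norm_of_nonneg hε.le]
    gcongr
    exact he1 0 _ le_rfl
  have hg := norm_le_gronwallBound_of_norm_deriv_right_le (f := f) (a := 0) (b := t) (K := K)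
    (ε := ε * (1 + L + K * (M + 1)))
    (fun s hs => (hf s hs.1).continuousWithinAt.mono Icc_subset_Ici_self)
    (fun s hs => (hf s hs.1).mono (Ici_subset_Ici.2 hs.1)) h0
    (fun s hs => by
      rw [norm_cos_smul_add_sin_smul_perp, hfn]
      exact hd s hs.1) t ⟨ht, le_rfl⟩
  rw [hfn, sub_zero] at hg
  have hg2 := hg.trans (gronwallBound_le hK (by positivity))
  have hexp : 1 ≤ Real.exp (K * t) := Real.one_le_exp (by positivity)
  calc ‖v t‖ ≤ Real.exp (K * t) * (‖v₀‖ + ε * (M + 1) + t * (ε * (1 + L + K * (M + 1))))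
        + Real.exp (K * t) * (ε * (M + 1)) :=
        (hvu t ht).trans (add_le_add hg2 (le_mul_of_one_le_left (by positivity) hexp))
    _ = Real.exp (K * t) * (‖v₀‖ + ε * (2 * (M + 1)) + t * (ε * (1 + L + K * (M + 1)))) := by ring
    _ ≤ _ := le_velocityBound hM hL hK hε.le (norm_nonneg _) ht (by linarith)
        (by nlinarith [mul_nonneg hK hM])

theorem IsScheme.norm_v_le (hE : IsLipField E M L K) (hε : 0 < ε) (hτ : 0 < τ) {y v : ℕ → Plane}
    (h : IsScheme E ε τ x₀ v₀ y v) (n : ℕ) :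
    ‖v n‖ ≤ velocityBound M L K ε ‖v₀‖ (n * τ) := by
  obtain ⟨hM, hL, hK⟩ := hE.nonneg
  let X : ℕ → Plane := fun n => y n + ε • perp (v n)
  -- Discrete counterpart of the drift subtraction. Only differences of the field occur, so no
  -- smooth approximation is needed.
  let u : ℕ → Plane := fun n => v n + ε • perp (E (n * τ, X n))
  have ht : ∀ n : ℕ, (0 : ℝ) ≤ n * τ := fun n => by positivity
  have hb : ∀ (n : ℕ) z, ‖E (n * τ, z)‖ ≤ M := fun n z => hE.bound _ _ (ht n)
  have hw : ∀ n, ‖v (n + 1) + ε • perp (E (n * τ, X n))‖ ≤ ‖u n‖ := by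
    intro n
    refine (norm_le_norm_add_smul_perp (τ / ε ^ 2) _).trans_eq ?_
    have h1 := h.v_succ hε hτ n
    have h2 : v (n + 1) = v n + (τ / ε) • E (n * τ, X n) - (τ / ε ^ 2) • perp (v (n + 1)) :=
      eq_sub_of_add_eq h1
    congr 1
    rw [perp_add, perp_smul, perp_perp, smul_add, add_add_add_comm, h1]
    simp only [u]
    match_scalars <;> field_simp
    ring
  have hv : ∀ n, ‖v (n + 1)‖ ≤ ‖u n‖ + ε * M := by
    intro n
    have h1 : v (n + 1) = (v (n + 1) + ε • perp (E (n * τ, X n))) - ε • perp (E (n * τ, X n)) := by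
      abel
    rw [h1]
    refine (norm_sub_le _ _).trans (add_le_add (hw n) ?_)
    rw [norm_smul, norm_perp, Real.norm_of_nonneg hε.le]
    gcongr
    exact hb n _
  -- The velocity jump is replaced using the scheme, which leaves only one power of `ε⁻¹`; it is
  -- compensated by the factor `ε` in `u`.
  have hX : ∀ n, ‖X (n + 1) - X n‖ ≤ 2 * M * τ + τ / ε * ‖v (n + 1)‖ := by
    intro n
    have h1 : v (n + 1) = v n + (τ / ε) • E (n * τ, X n) - (τ / ε ^ 2) • perp (v (n + 1)) :=
      eq_sub_of_add_eq (h.v_succ hε hτ n)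
    have h2 : perp (v (n + 1)) =
        perp (v n) + (τ / ε) • perp (E (n * τ, X n)) + (τ / ε ^ 2) • v (n + 1) := by
      conv_lhs => rw [h1]
      rw [perp_sub, perp_add, perp_smul, perp_smul, perp_perp]
      module
    have h3 : X (n + 1) - X n = τ • perp (E (n * τ, X n))
        - τ • perp (E (n * τ, y n + ε • perp (v (n + 1)))) + (τ / ε) • v (n + 1) := by
      have h4 : X (n + 1) - X n = y (n + 1) - y n + ε • (perp (v (n + 1)) - perp (v n)) := by
        simp only [X]; module
      have h5 : perp (v (n + 1)) - perp (v n) =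
          (τ / ε) • perp (E (n * τ, X n)) + (τ / ε ^ 2) • v (n + 1) := by
        rw [sub_eq_iff_eq_add, h2]; abel
      rw [h4, h5, h.y_succ hτ n]
      match_scalars <;> field_simp <;> ring
    rw [h3]
    refine (norm_add_le _ _).trans (add_le_add ((norm_sub_le _ _).trans ?_) ?_)
    · rw [norm_smul, norm_smul, norm_perp, norm_perp, Real.norm_of_nonneg hτ.le]
      nlinarith [hb n (X n), hb n (y n + ε • perp (v (n + 1)))]
    · rw [norm_smul, Real.norm_of_nonneg (by positivity)]
  have hstep : ∀ n, ‖u (n + 1)‖ ≤ (1 + K * τ) * ‖u n‖ + τ * (ε * (L + 3 * K * M)) := by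
    intro n
    have h1 : u (n + 1) = (v (n + 1) + ε • perp (E (n * τ, X n))) +
        ε • perp (E ((n + 1 : ℕ) * τ, X (n + 1)) - E (n * τ, X n)) := by
      simp only [u, perp_sub]; module
    have h2 : ‖E ((n + 1 : ℕ) * τ, X (n + 1)) - E (n * τ, X n)‖ ≤
        L * τ + K * (2 * M * τ + τ / ε * ‖v (n + 1)‖) := by
      have h3 := hE.lip_t ((n + 1 : ℕ) * τ) (n * τ) (X (n + 1)) (ht _) (ht _)
      have h4 := hE.lip_x (n * τ) (X (n + 1)) (X n) (ht _)
      have h5 : ((n + 1 : ℕ) * τ - n * τ : ℝ) = τ := by push_cast; ring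
      rw [h5, abs_of_pos hτ] at h3
      refine (norm_sub_le_norm_sub_add_norm_sub _ (E (n * τ, X (n + 1))) _).trans
        (add_le_add h3 (h4.trans ?_))
      gcongr
      exact hX n
    rw [h1]
    refine (norm_add_le _ _).trans ?_
    rw [norm_smul, norm_perp, Real.norm_of_nonneg hε.le]
    calc _ ≤ ‖u n‖ + ε * (L * τ + K * (2 * M * τ + τ / ε * ‖v (n + 1)‖)) := by
          gcongr
          exact hw n
      _ = ‖u n‖ + ε * τ * (L + 2 * K * M) + K * τ * ‖v (n + 1)‖ := by field_simp; ring
      _ ≤ ‖u n‖ + ε * τ * (L + 2 * K * M) + K * τ * (‖u n‖ + ε * M) := by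
          gcongr
          exact hv n
      _ = _ := by ring
  have hn := discrete_gronwall_exp (s := fun n => ‖u n‖) (q := K * τ)
    (D := τ * (ε * (L + 3 * K * M))) (by positivity) (by positivity) (norm_nonneg _) n
    fun k _ => (hstep k).trans (by
      have h1 : 1 ≤ Real.exp (K * τ * (k + 1)) := Real.one_le_exp (by positivity)
      have h2 : 0 ≤ τ * (ε * (L + 3 * K * M)) := by positivity
      nlinarith)
  have h0 : ‖u 0‖ ≤ ‖v₀‖ + ε * M := by
    refine (norm_add_le _ _).trans ?_
    rw [h.init_v, norm_smul, norm_perp, Real.norm_of_nonneg hε.le]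
    gcongr
    exact hb 0 _
  have hvn : ‖v n‖ ≤ ‖u n‖ + ε * M := by
    have h1 : v n = u n - ε • perp (E (n * τ, X n)) := by simp [u]
    rw [h1]
    refine (norm_sub_le _ _).trans ?_
    rw [norm_smul, norm_perp, Real.norm_of_nonneg hε.le]
    gcongr
    exact hb n _
  have hexp : 1 ≤ Real.exp (K * (n * τ)) := Real.one_le_exp (by positivity)
  calc ‖v n‖ ≤ (‖v₀‖ + ε * M + n * (τ * (ε * (L + 3 * K * M)))) * Real.exp (K * τ * n)
        + Real.exp (K * (n * τ)) * (ε * M) := by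
        refine hvn.trans (add_le_add (hn.trans ?_)
          (le_mul_of_one_le_left (by positivity) hexp))
        gcongr
    _ = Real.exp (K * (n * τ)) * (‖v₀‖ + ε * (2 * M) + n * τ * (ε * (L + 3 * K * M))) := by
        rw [show K * τ * n = K * (n * τ) by ring]; ring
    _ ≤ _ := le_velocityBound hM hL hK hε.le (norm_nonneg _) (ht n) (by linarith)
        (by nlinarith [mul_nonneg hK hM])

end VelocityBounds

/-! ### Local errors over one time step. -/

section Consistency

theorem norm_step_le {f f' : ℝ → Plane} (hf : ∀ s, 0 ≤ s → HasDerivWithinAt f (f' s) (Ici 0) s)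
    {t τ B : ℝ} {c : Plane} (ht : 0 ≤ t) (hτ : 0 < τ)
    (hB : ∀ s ∈ Icc t (t + τ), ‖f' s - c‖ ≤ B) : ‖f (t + τ) - f t - τ • c‖ ≤ τ * B := by
  have h1 : ∀ s ∈ Icc t (t + τ), HasDerivWithinAt (fun s => f s - s • c) (f' s - c)
      (Icc t (t + τ)) s := by
    intro s hs
    have h2 := (hf s (ht.trans hs.1)).mono (fun r hr => ht.trans hr.1 : Icc t (t + τ) ⊆ Ici 0)
    exact (h2.sub ((hasDerivWithinAt_id s _).smul_const c)).congr_deriv (by rw [one_smul])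
  have h3 := (convex_Icc t (t + τ)).norm_image_sub_le_of_norm_hasDerivWithin_le h1 hB
    (left_mem_Icc.2 (by linarith)) (right_mem_Icc.2 (by linarith))
  rw [add_sub_cancel_left, Real.norm_of_nonneg hτ.le, mul_comm B] at h3
  refine le_of_eq_of_le (congrArg _ ?_) h3
  module

theorem norm_increment_le {f f' : ℝ → Plane}
    (hf : ∀ s, 0 ≤ s → HasDerivWithinAt f (f' s) (Ici 0) s) {t τ B r s : ℝ} (ht : 0 ≤ t)
    (hB : ∀ s ∈ Icc t (t + τ), ‖f' s‖ ≤ B) (hr : r ∈ Icc t (t + τ)) (hs : s ∈ Icc t (t + τ)) :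
    ‖f r - f s‖ ≤ B * τ := by
  have h1 : ∀ s ∈ Icc t (t + τ), HasDerivWithinAt f (f' s) (Icc t (t + τ)) s := fun s hs =>
    (hf s (ht.trans hs.1)).mono (fun r hr => ht.trans hr.1 : Icc t (t + τ) ⊆ Ici 0)
  refine ((convex_Icc t (t + τ)).norm_image_sub_le_of_norm_hasDerivWithin_le h1 hB hs hr).trans ?_
  refine mul_le_mul_of_nonneg_left ?_ ((norm_nonneg _).trans (hB s hs))
  rw [Real.norm_eq_abs, abs_le]
  constructor <;> linarith [hr.1, hr.2, hs.1, hs.2]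

/-- The guiding center variable `y = x - ε v^⊥`. -/
noncomputable def guidingCenter (ε : ℝ) (x v : ℝ → Plane) (t : ℝ) : Plane := x t - ε • perp (v t)

theorem guidingCenter_add (ε : ℝ) (x v : ℝ → Plane) (t : ℝ) :
    guidingCenter ε x v t + ε • perp (v t) = x t := sub_add_cancel _ _

variable {E : SpaceTime → Plane} {M L K ε τ t W : ℝ} {x₀ v₀ : Plane} {x v : ℝ → Plane}

theorem IsLipField.norm_sub_le (hE : IsLipField E M L K) {s t : ℝ} (hs : 0 ≤ s) (ht : 0 ≤ t)
    (z w : Plane) : ‖E (s, z) - E (t, w)‖ ≤ L * |s - t| + K * ‖z - w‖ :=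
  (norm_sub_le_norm_sub_add_norm_sub _ (E (t, z)) _).trans
    (add_le_add (hE.lip_t s t z hs ht) (hE.lip_x t z w ht))

theorem IsLipField.norm_sub_le_of_mem (hE : IsLipField E M L K) {s : ℝ} (ht : 0 ≤ t)
    (hs : s ∈ Icc t (t + τ)) (z w : Plane) : ‖E (s, z) - E (t, w)‖ ≤ L * τ + K * ‖z - w‖ := by
  refine (hE.norm_sub_le (ht.trans hs.1) ht z w).trans ?_
  have := hE.nonneg.2.1
  gcongr
  rw [abs_le]
  constructor <;> linarith [hs.1, hs.2]

/-- The fast terms `v / ε` of `x'` and `ε (v')^⊥` cancel, leaving a drift bounded by `M` uniformly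
in `ε`. -/
theorem IsCharacteristic.hasDerivWithinAt_guidingCenter (h : IsCharacteristic E ε x₀ v₀ x v)
    (hε : 0 < ε) (s : ℝ) (hs : 0 ≤ s) :
    HasDerivWithinAt (guidingCenter ε x v) (-perp (E (s, x s))) (Ici 0) s := by
  have h1 := (h.deriv_x s hs).sub
    ((perpCLM.hasFDerivAt.comp_hasDerivWithinAt s (h.deriv_v s hs)).const_smul ε)
  refine h1.congr_deriv ?_
  simp only [perpCLM_apply, perp_smul, perp_sub, perp_perp]
  match_scalars <;> field_simp
  ring

theorem IsCharacteristic.norm_guidingCenter_sub_le (hE : IsLipField E M L K)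
    (h : IsCharacteristic E ε x₀ v₀ x v) (hε : 0 < ε) (ht : 0 ≤ t) {r s : ℝ}
    (hr : r ∈ Icc t (t + τ)) (hs : s ∈ Icc t (t + τ)) :
    ‖guidingCenter ε x v r - guidingCenter ε x v s‖ ≤ M * τ :=
  norm_increment_le (h.hasDerivWithinAt_guidingCenter hε) ht
    (fun s hs => by rw [norm_neg, norm_perp]; exact hE.bound _ _ (ht.trans hs.1)) hr hs

theorem IsCharacteristic.norm_v_sub_le (hE : IsLipField E M L K)
    (h : IsCharacteristic E ε x₀ v₀ x v) (hε : 0 < ε) (ht : 0 ≤ t)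
    (hW : ∀ s ∈ Icc t (t + τ), ‖v s‖ ≤ W) {r s : ℝ}
    (hr : r ∈ Icc t (t + τ)) (hs : s ∈ Icc t (t + τ)) :
    ‖v r - v s‖ ≤ (ε⁻¹ * (M + ε⁻¹ * W)) * τ := by
  refine norm_increment_le h.deriv_v ht (fun s hs => ?_) hr hs
  rw [norm_smul, Real.norm_of_nonneg (by positivity)]
  gcongr
  refine (norm_sub_le _ _).trans ?_
  rw [norm_smul, norm_perp, Real.norm_of_nonneg (by positivity)]
  gcongr
  · exact hE.bound _ _ (ht.trans hs.1)
  · exact hW s hs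

theorem IsCharacteristic.norm_x_sub_le (h : IsCharacteristic E ε x₀ v₀ x v) (hε : 0 < ε)
    (ht : 0 ≤ t) (hW : ∀ s ∈ Icc t (t + τ), ‖v s‖ ≤ W) {r s : ℝ}
    (hr : r ∈ Icc t (t + τ)) (hs : s ∈ Icc t (t + τ)) :
    ‖x r - x s‖ ≤ (ε⁻¹ * W) * τ := by
  refine norm_increment_le h.deriv_x ht (fun s hs => ?_) hr hs
  rw [norm_smul, Real.norm_of_nonneg (by positivity)]
  gcongr
  exact hW s hs

/-- Consistency error of the velocity step. -/
theorem IsCharacteristic.consistency_v (hE : IsLipField E M L K)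
    (h : IsCharacteristic E ε x₀ v₀ x v) (hε : 0 < ε) (hτ : 0 < τ) (ht : 0 ≤ t)
    (hW : ∀ s ∈ Icc t (t + τ), ‖v s‖ ≤ W) :
    ‖v (t + τ) + (τ / ε ^ 2) • perp (v (t + τ)) - (v t + (τ / ε) • E (t, x t))‖ ≤
      τ * (ε⁻¹ * (L * τ + K * ((ε⁻¹ * W) * τ)) +
        ε⁻¹ * (ε⁻¹ * ((ε⁻¹ * (M + ε⁻¹ * W)) * τ))) := by
  have hK := hE.nonneg.2.2
  have hmem : t ∈ Icc t (t + τ) := left_mem_Icc.2 (by linarith)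
  have hmem' : t + τ ∈ Icc t (t + τ) := right_mem_Icc.2 (by linarith)
  -- The constant slope freezes the field at the start of the step and the rotation at its end, as
  -- the scheme does.
  have key := norm_step_le h.deriv_v ht hτ
    (c := ε⁻¹ • (E (t, x t) - ε⁻¹ • perp (v (t + τ))))
    (B := ε⁻¹ * (L * τ + K * ((ε⁻¹ * W) * τ)) + ε⁻¹ * (ε⁻¹ * ((ε⁻¹ * (M + ε⁻¹ * W)) * τ)))
    (fun s hs => by
      have e1 : ε⁻¹ • (E (s, x s) - ε⁻¹ • perp (v s)) -
          ε⁻¹ • (E (t, x t) - ε⁻¹ • perp (v (t + τ))) =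
          ε⁻¹ • (E (s, x s) - E (t, x t)) - ε⁻¹ • ε⁻¹ • perp (v s - v (t + τ)) := by
        rw [perp_sub]; module
      rw [e1]
      refine (norm_sub_le _ _).trans ?_
      rw [norm_smul, norm_smul, norm_smul, norm_perp, Real.norm_of_nonneg (by positivity)]
      gcongr
      · refine (hE.norm_sub_le_of_mem ht hs _ _).trans ?_
        gcongr
        exact h.norm_x_sub_le hε ht hW hs hmem
      · exact h.norm_v_sub_le hE hε ht hW hs hmem')
  refine le_of_eq_of_le (congrArg _ ?_) key
  match_scalars <;> field_simp

/-- Consistency error of the guiding center step, evaluated along the exact velocities. -/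
theorem IsCharacteristic.consistency_y (hE : IsLipField E M L K)
    (h : IsCharacteristic E ε x₀ v₀ x v) (hε : 0 < ε) (hτ : 0 < τ) (ht : 0 ≤ t)
    (hW : ∀ s ∈ Icc t (t + τ), ‖v s‖ ≤ W) :
    ‖guidingCenter ε x v (t + τ) - (guidingCenter ε x v t -
        τ • perp (E (t, guidingCenter ε x v t + ε • perp (v (t + τ)))))‖ ≤
      τ * (L * τ + K * (M * τ + ε * ((ε⁻¹ * (M + ε⁻¹ * W)) * τ))) := by
  have hK := hE.nonneg.2.2
  have hmem : t ∈ Icc t (t + τ) := left_mem_Icc.2 (by linarith)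
  have hmem' : t + τ ∈ Icc t (t + τ) := right_mem_Icc.2 (by linarith)
  have key := norm_step_le (h.hasDerivWithinAt_guidingCenter hε) ht hτ
    (c := -perp (E (t, guidingCenter ε x v t + ε • perp (v (t + τ)))))
    (B := L * τ + K * (M * τ + ε * ((ε⁻¹ * (M + ε⁻¹ * W)) * τ)))
    (fun s hs => by
      rw [← perp_neg, ← perp_neg, ← perp_sub, norm_perp, ← neg_sub', norm_neg]
      refine (hE.norm_sub_le_of_mem ht hs _ _).trans ?_
      gcongr
      rw [← guidingCenter_add ε x v s]
      have e1 : guidingCenter ε x v s + ε • perp (v s) -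
          (guidingCenter ε x v t + ε • perp (v (t + τ))) =
          guidingCenter ε x v s - guidingCenter ε x v t + ε • perp (v s - v (t + τ)) := by
        rw [perp_sub]; module
      rw [e1]
      refine (norm_add_le _ _).trans ?_
      rw [norm_smul, norm_perp, Real.norm_of_nonneg hε.le]
      gcongr
      · exact h.norm_guidingCenter_sub_le hE hε ht hs hmem
      · exact h.norm_v_sub_le hE hε ht hW hs hmem')
  refine le_of_eq_of_le (congrArg _ ?_) key
  module

/-- Consistency error of the explicit Euler step for the limiting guiding center dynamics. -/
theorem IsCharacteristic.consistency_limit (hE : IsLipField E M L K)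
    (h : IsCharacteristic E ε x₀ v₀ x v) (hε : 0 < ε) (hτ : 0 < τ) (ht : 0 ≤ t)
    (hW : ∀ s ∈ Icc t (t + τ), ‖v s‖ ≤ W) :
    ‖guidingCenter ε x v (t + τ) - (guidingCenter ε x v t -
        τ • perp (E (t, guidingCenter ε x v t)))‖ ≤ τ * (L * τ + K * (M * τ + ε * W)) := by
  have hK := hE.nonneg.2.2
  have hmem : t ∈ Icc t (t + τ) := left_mem_Icc.2 (by linarith)
  have key := norm_step_le (h.hasDerivWithinAt_guidingCenter hε) ht hτ
    (c := -perp (E (t, guidingCenter ε x v t))) (B := L * τ + K * (M * τ + ε * W))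
    (fun s hs => by
      rw [← perp_neg, ← perp_neg, ← perp_sub, norm_perp, ← neg_sub', norm_neg]
      refine (hE.norm_sub_le_of_mem ht hs _ _).trans ?_
      gcongr
      rw [← guidingCenter_add ε x v s, add_sub_right_comm]
      refine (norm_add_le _ _).trans ?_
      rw [norm_smul, norm_perp, Real.norm_of_nonneg hε.le]
      gcongr
      · exact h.norm_guidingCenter_sub_le hE hε ht hs hmem
      · exact hW s hs)
  refine le_of_eq_of_le (congrArg _ ?_) key
  module

end Consistency

/-! ### Global errors for Lipschitz fields. -/

section FirstOrderEstimates

variable {E : SpaceTime → Plane} {M L K ε τ : ℝ} {x₀ v₀ : Plane} {x v : ℝ → Plane}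
  {yd vd : ℕ → Plane}

/-- The non-exponential factor in the velocity bound. -/
noncomputable def velocityFactor (M L K ε b t : ℝ) : ℝ :=
  (4 + 2 * M + L + K * (3 * M + 1)) * (1 + t) * (b + ε)

theorem velocityFactor_nonneg {b t : ℝ} (hE : IsLipField E M L K) (hε : 0 < ε) (hb : 0 ≤ b)
    (ht : 0 ≤ t) : 0 ≤ velocityFactor M L K ε b t := by
  obtain ⟨hM, hL, hK⟩ := hE.nonneg
  unfold velocityFactor
  positivity

/-- The polynomial factor is frozen at the final time so that it can enter the constant `D` of the
discrete Gronwall lemma; the exponential stays at the current time. -/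
theorem velocityBound_le {b s t : ℝ} (hE : IsLipField E M L K) (hε : 0 < ε) (hb : 0 ≤ b)
    (hst : s ≤ t) :
    velocityBound M L K ε b s ≤ velocityFactor M L K ε b t * Real.exp (K * s) := by
  obtain ⟨hM, hL, hK⟩ := hE.nonneg
  have : velocityBound M L K ε b s = velocityFactor M L K ε b s * Real.exp (K * s) := by
    unfold velocityBound velocityFactor; ring
  rw [this]
  unfold velocityFactor
  gcongr

theorem add_one_mul_step (k : ℕ) (τ : ℝ) : ((k + 1 : ℕ) : ℝ) * τ = k * τ + τ := by
  push_cast; ring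

theorem IsScheme.velocity_bounds (hE : IsLipField E M L K)
    (happ : ∀ δ > 0, ∃ e, IsSmoothApprox E e L K δ) (hε : 0 < ε) (hτ : 0 < τ)
    (h : IsCharacteristic E ε x₀ v₀ x v) (hd : IsScheme E ε τ x₀ v₀ yd vd) {k n : ℕ} (hk : k ≤ n) :
    ‖vd k‖ ≤ velocityFactor M L K ε ‖v₀‖ (n * τ) * Real.exp (K * (k * τ)) ∧
      ∀ s ∈ Icc 0 (k * τ),
        ‖v s‖ ≤ velocityFactor M L K ε ‖v₀‖ (n * τ) * Real.exp (K * (k * τ)) := by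
  obtain ⟨hM, hL, hK⟩ := hE.nonneg
  have hkn : (k : ℝ) * τ ≤ n * τ := by gcongr
  have hb := velocityBound_le hE hε (norm_nonneg v₀) hkn
  refine ⟨(hd.norm_v_le hE hε hτ k).trans hb, fun s hs => ?_⟩
  exact ((h.norm_v_le hE happ hε hs.1).trans
    (velocityBound_mono hM hL hK hε.le (norm_nonneg _) hs.1 hs.2)).trans hb

theorem growth_exponent_eq (K τ : ℝ) (n : ℕ) :
    (2 + K * τ) * K * τ * n = (2 + K * τ) * K * (n * τ) := by ring

/-- The rate `(2 + K τ) K` is at least `2 K`, which leaves room for the square of the exponential in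
the velocity bound, or for one such exponential times `1 + K τ`. -/
theorem exp_growth (hK : 0 ≤ K) (hτ : 0 < τ) (k : ℕ) :
    1 ≤ Real.exp (K * ((k + 1 : ℕ) * τ)) ∧
    (1 + K * τ) ≤ Real.exp (K * ((k + 1 : ℕ) * τ)) ∧
    Real.exp (K * ((k + 1 : ℕ) * τ)) ^ 2 ≤ Real.exp ((2 + K * τ) * K * τ * (k + 1)) := by
  refine ⟨Real.one_le_exp (by positivity), ?_, ?_⟩
  · refine (by linarith [Real.add_one_le_exp (K * τ)] : 1 + K * τ ≤ Real.exp (K * τ)).trans ?_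
    rw [Real.exp_le_exp]
    push_cast
    have : 0 ≤ K * (k * τ) := by positivity
    linarith
  · rw [← Real.exp_nat_mul, Real.exp_le_exp]
    push_cast
    have : 0 ≤ K * τ * (K * τ) * (k + 1) := by positivity
    linarith

/-- Error of the scheme in all variables, not uniform with respect to the stiffness. -/
theorem IsScheme.error_le (hE : IsLipField E M L K)
    (happ : ∀ δ > 0, ∃ e, IsSmoothApprox E e L K δ) (hε : 0 < ε) (hτ : 0 < τ)
    (h : IsCharacteristic E ε x₀ v₀ x v) (hd : IsScheme E ε τ x₀ v₀ yd vd) (n : ℕ) :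
    ‖yd n - guidingCenter ε x v (n * τ)‖ + ε * ‖vd n - v (n * τ)‖ ≤
      n * τ * (τ * (2 * L + 2 * K * M + M / ε ^ 2 +
        (2 * K / ε + 1 / ε ^ 3) * velocityFactor M L K ε ‖v₀‖ (n * τ))) *
        Real.exp ((2 + K * τ) * K * (n * τ)) := by
  obtain ⟨hM, hL, hK⟩ := hE.nonneg
  set Q := velocityFactor M L K ε ‖v₀‖ (n * τ) with hQ
  have hQ0 : 0 ≤ Q := velocityFactor_nonneg hE hε (norm_nonneg _) (by positivity)
  let a : ℕ → ℝ := fun k => ‖yd k - guidingCenter ε x v (k * τ)‖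
  -- The weight `ε` makes `a + b` control the error on `x = y + ε v^⊥`, which is the argument of the
  -- field.
  let b : ℕ → ℝ := fun k => ε * ‖vd k - v (k * τ)‖
  have key := discrete_gronwall_exp (s := fun k => a k + b k) (q := (2 + K * τ) * K * τ)
    (D := τ * (τ * (2 * L + 2 * K * M + M / ε ^ 2 + (2 * K / ε + 1 / ε ^ 3) * Q)))
    (by positivity) (by positivity) (by positivity) n ?_
  · have h0 : a 0 + b 0 = 0 := by
      simp [a, b, guidingCenter, h.init_x, h.init_v, hd.init_y, hd.init_v]
    simp only [h0, zero_add, growth_exponent_eq] at key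
    refine key.trans_eq ?_
    ring
  intro k hk
  obtain ⟨hexp1, hexp2, hexp3⟩ := exp_growth hK hτ k
  set X := Real.exp (K * ((k + 1 : ℕ) * τ))
  set W := Q * X
  have hW0 : 0 ≤ W := by positivity
  have hkτ : (0 : ℝ) ≤ k * τ := by positivity
  have hWv : ∀ s ∈ Icc (k * τ) (k * τ + τ), ‖v s‖ ≤ W := fun s hs =>
    (IsScheme.velocity_bounds hE happ hε hτ h hd (Nat.succ_le_of_lt hk)).2 s
      ⟨hkτ.trans hs.1, by rw [add_one_mul_step]; exact hs.2⟩
  have hcv := h.consistency_v hE hε hτ hkτ hWv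
  have hcy := h.consistency_y hE hε hτ hkτ hWv
  rw [← add_one_mul_step] at hcv hcy
  have hx : ‖yd k + ε • perp (vd k) - x (k * τ)‖ ≤ a k + b k := by
    rw [← guidingCenter_add ε x v, add_sub_add_comm, ← smul_sub, ← perp_sub]
    refine (norm_add_le _ _).trans_eq ?_
    rw [norm_smul, norm_perp, Real.norm_of_nonneg hε.le]
  have hb : b (k + 1) ≤ b k + K * τ * (a k + b k) +
      τ ^ 2 * (L + K * W / ε + M / ε ^ 2 + W / ε ^ 3) := by
    have h1 : ‖vd (k + 1) - v ((k + 1 : ℕ) * τ)‖ ≤ ‖vd k - v (k * τ)‖ +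
        τ / ε * (K * (a k + b k)) + τ * (ε⁻¹ * (L * τ + K * ((ε⁻¹ * W) * τ)) +
          ε⁻¹ * (ε⁻¹ * ((ε⁻¹ * (M + ε⁻¹ * W)) * τ))) := by
      refine (norm_le_norm_add_smul_perp (τ / ε ^ 2) _).trans ?_
      have e1 : vd (k + 1) - v ((k + 1 : ℕ) * τ) +
          (τ / ε ^ 2) • perp (vd (k + 1) - v ((k + 1 : ℕ) * τ)) =
          (vd k - v (k * τ)) +
            (τ / ε) • (E (k * τ, yd k + ε • perp (vd k)) - E (k * τ, x (k * τ))) -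
          (v ((k + 1 : ℕ) * τ) + (τ / ε ^ 2) • perp (v ((k + 1 : ℕ) * τ)) -
            (v (k * τ) + (τ / ε) • E (k * τ, x (k * τ)))) := by
        rw [perp_sub]
        linear_combination (norm := module) hd.v_succ hε hτ k
      rw [e1]
      refine (norm_sub_le _ _).trans (add_le_add ((norm_add_le _ _).trans ?_) hcv)
      rw [norm_smul, Real.norm_of_nonneg (by positivity)]
      gcongr
      refine (hE.lip_x _ _ _ hkτ).trans ?_
      gcongr
    calc b (k + 1) ≤ ε * (‖vd k - v (k * τ)‖ +
        τ / ε * (K * (a k + b k)) + τ * (ε⁻¹ * (L * τ + K * ((ε⁻¹ * W) * τ)) +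
          ε⁻¹ * (ε⁻¹ * ((ε⁻¹ * (M + ε⁻¹ * W)) * τ)))) := by
          show ε * _ ≤ _
          gcongr
      _ = _ := by
        simp only [b]
        field_simp
        ring
  have ha : a (k + 1) ≤ a k + K * τ * (a k + b (k + 1)) +
      τ ^ 2 * (L + 2 * K * M + K * W / ε) := by
    have e1 : yd (k + 1) - guidingCenter ε x v ((k + 1 : ℕ) * τ) =
        (yd k - guidingCenter ε x v (k * τ)) -
          τ • perp (E (k * τ, yd k + ε • perp (vd (k + 1))) -
            E (k * τ, guidingCenter ε x v (k * τ) + ε • perp (v ((k + 1 : ℕ) * τ)))) -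
        (guidingCenter ε x v ((k + 1 : ℕ) * τ) - (guidingCenter ε x v (k * τ) -
          τ • perp (E (k * τ, guidingCenter ε x v (k * τ) +
            ε • perp (v ((k + 1 : ℕ) * τ)))))) := by
      rw [hd.y_succ hτ k, perp_sub]
      module
    have h2 : ‖E (k * τ, yd k + ε • perp (vd (k + 1))) -
        E (k * τ, guidingCenter ε x v (k * τ) + ε • perp (v ((k + 1 : ℕ) * τ)))‖ ≤
        K * (a k + b (k + 1)) := by
      refine (hE.lip_x _ _ _ hkτ).trans ?_
      gcongr
      rw [add_sub_add_comm, ← smul_sub, ← perp_sub]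
      refine (norm_add_le _ _).trans_eq ?_
      rw [norm_smul, norm_perp, Real.norm_of_nonneg hε.le]
    calc a (k + 1) ≤ (a k + τ * (K * (a k + b (k + 1)))) +
          τ * (L * τ + K * (M * τ + ε * ((ε⁻¹ * (M + ε⁻¹ * W)) * τ))) := by
          show ‖_‖ ≤ _
          rw [e1]
          refine (norm_sub_le _ _).trans (add_le_add ((norm_sub_le _ _).trans ?_) hcy)
          rw [norm_smul, norm_perp, Real.norm_of_nonneg hτ.le]
          gcongr
      _ = _ := by field_simp; ring
  -- The guiding center step uses the updated velocity, so `b (k + 1)` reenters the bound for `a (k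
  -- + 1)`. The growth factor is therefore `(1 + K τ)²`, the origin of the exponent in the theorem.
  have hab : a (k + 1) + b (k + 1) ≤ (1 + (2 + K * τ) * K * τ) * (a k + b k) +
      τ * (τ * ((2 * L + 2 * K * M + M / ε ^ 2 + (2 * K / ε + 1 / ε ^ 3) * W) *
        (1 + K * τ))) := by
    have h1 : 0 ≤ 1 + K * τ := by positivity
    have h2 := mul_le_mul_of_nonneg_left hb h1
    have h3 : 0 ≤ K * τ * (τ ^ 2 * (L + 2 * K * M + K * W / ε)) := by positivity
    have h4 : (2 * K / ε + 1 / ε ^ 3) * W = 2 * (K * W / ε) + W / ε ^ 3 := by field_simp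
    rw [h4]
    nlinarith
  refine hab.trans ?_
  gcongr (1 + (2 + K * τ) * K * τ) * (a k + b k) + ?_
  calc _ ≤ τ * (τ * (((2 * L + 2 * K * M + M / ε ^ 2 + (2 * K / ε + 1 / ε ^ 3) * Q) * X) * X)) := by
        gcongr τ * (τ * (?_ * ?_))
        have h1 : 2 * L + 2 * K * M + M / ε ^ 2 ≤ (2 * L + 2 * K * M + M / ε ^ 2) * X :=
          le_mul_of_one_le_right (by positivity) hexp1
        simp only [W]
        linarith
    _ = τ * (τ * (2 * L + 2 * K * M + M / ε ^ 2 + (2 * K / ε + 1 / ε ^ 3) * Q)) * X ^ 2 := by ring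
    _ ≤ _ := by gcongr

/-- Error on the guiding center, uniform with respect to the stiffness. -/
theorem IsScheme.guidingCenter_error_le (hE : IsLipField E M L K)
    (happ : ∀ δ > 0, ∃ e, IsSmoothApprox E e L K δ) (hε : 0 < ε) (hτ : 0 < τ)
    (h : IsCharacteristic E ε x₀ v₀ x v) (hd : IsScheme E ε τ x₀ v₀ yd vd) (n : ℕ) :
    ‖yd n - guidingCenter ε x v (n * τ)‖ ≤
      n * τ * (τ * (L + K * M) + 2 * K * ε * velocityFactor M L K ε ‖v₀‖ (n * τ)) *
        Real.exp ((2 + K * τ) * K * (n * τ)) := by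
  obtain ⟨hM, hL, hK⟩ := hE.nonneg
  set Q := velocityFactor M L K ε ‖v₀‖ (n * τ) with hQ
  have hQ0 : 0 ≤ Q := velocityFactor_nonneg hE hε (norm_nonneg _) (by positivity)
  let a : ℕ → ℝ := fun k => ‖yd k - guidingCenter ε x v (k * τ)‖
  have key := discrete_gronwall_exp (s := a) (q := (2 + K * τ) * K * τ)
    (D := τ * (τ * (L + K * M) + 2 * K * ε * Q))
    (by positivity) (by positivity) (by positivity) n ?_
  · have h0 : a 0 = 0 := by
      simp [a, guidingCenter, h.init_x, h.init_v, hd.init_y]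
    simp only [h0, zero_add, growth_exponent_eq] at key
    refine key.trans_eq ?_
    ring
  intro k hk
  obtain ⟨hexp1, hexp2, hexp3⟩ := exp_growth hK hτ k
  set X := Real.exp (K * ((k + 1 : ℕ) * τ))
  set W := Q * X
  have hW0 : 0 ≤ W := by positivity
  have hkτ : (0 : ℝ) ≤ k * τ := by positivity
  obtain ⟨hWd, hWv⟩ := IsScheme.velocity_bounds hE happ hε hτ h hd (Nat.succ_le_of_lt hk)
  have hWv : ∀ s ∈ Icc (k * τ) (k * τ + τ), ‖v s‖ ≤ W := fun s hs =>
    hWv s ⟨hkτ.trans hs.1, by rw [add_one_mul_step]; exact hs.2⟩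
  have hcy := h.consistency_limit hE hε hτ hkτ hWv
  rw [← add_one_mul_step] at hcy
  -- Both evolutions are compared with the Euler step from the exact guiding center. No velocity
  -- difference appears, so only the size of the velocities matters.
  have e1 : yd (k + 1) - guidingCenter ε x v ((k + 1 : ℕ) * τ) =
      (yd k - guidingCenter ε x v (k * τ)) -
        τ • perp (E (k * τ, yd k + ε • perp (vd (k + 1))) -
          E (k * τ, guidingCenter ε x v (k * τ))) -
      (guidingCenter ε x v ((k + 1 : ℕ) * τ) - (guidingCenter ε x v (k * τ) -
        τ • perp (E (k * τ, guidingCenter ε x v (k * τ))))) := by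
    rw [hd.y_succ hτ k, perp_sub]
    module
  have h2 : ‖E (k * τ, yd k + ε • perp (vd (k + 1))) -
      E (k * τ, guidingCenter ε x v (k * τ))‖ ≤ K * (a k + ε * W) := by
    refine (hE.lip_x _ _ _ hkτ).trans ?_
    gcongr
    rw [add_sub_right_comm]
    refine (norm_add_le _ _).trans ?_
    rw [norm_smul, norm_perp, Real.norm_of_nonneg hε.le]
    gcongr
  calc a (k + 1) ≤ (a k + τ * (K * (a k + ε * W))) + τ * (L * τ + K * (M * τ + ε * W)) := by
        show ‖_‖ ≤ _
        rw [e1]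
        refine (norm_sub_le _ _).trans (add_le_add ((norm_sub_le _ _).trans ?_) hcy)
        rw [norm_smul, norm_perp, Real.norm_of_nonneg hτ.le]
        gcongr
    _ = (1 + K * τ) * a k + τ * (τ * (L + K * M) * 1 + 2 * K * ε * Q * X) := by
        simp only [W]; ring
    _ ≤ (1 + (2 + K * τ) * K * τ) * a k + τ * (τ * (L + K * M) * X ^ 2 + 2 * K * ε * Q * X ^ 2) := by
        have h5 : X ≤ X ^ 2 := by nlinarith
        have h6 : 1 + K * τ ≤ 1 + (2 + K * τ) * K * τ := by
          have : 0 ≤ K * τ := by positivity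
          nlinarith
        have h7 : 0 ≤ a k := norm_nonneg _
        have h8 : 1 ≤ X ^ 2 := hexp1.trans h5
        gcongr
    _ = (1 + (2 + K * τ) * K * τ) * a k + τ * (τ * (L + K * M) + 2 * K * ε * Q) * X ^ 2 := by
        ring
    _ ≤ _ := by gcongr

end FirstOrderEstimates

/-! ### Averaging with a corrector for fields with bounded second derivatives. -/

section SecondOrderEstimates

theorem norm_fderiv_sub_le {e : SpaceTime → Plane} (he : ContDiff ℝ ∞ e) {H : ℝ}
    (hH : ∀ z : SpaceTime, 0 ≤ z.1 → ‖fderiv ℝ (fderiv ℝ e) z‖ ≤ H) {z w : SpaceTime}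
    (hz : 0 ≤ z.1) (hw : 0 ≤ w.1) : ‖fderiv ℝ e z - fderiv ℝ e w‖ ≤ H * ‖z - w‖ := by
  have hd : Differentiable ℝ (fderiv ℝ e) :=
    (he.fderiv_right (m := 1) (by norm_cast)).differentiable (by simp)
  have hconv : Convex ℝ {z : SpaceTime | 0 ≤ z.1} :=
    (convex_Ici (0 : ℝ)).linear_preimage (LinearMap.fst ℝ ℝ Plane)
  exact hconv.norm_image_sub_le_of_norm_hasFDerivWithin_le
    (fun z _ => (hd z).hasFDerivAt.hasFDerivWithinAt) hH hw hz

theorem norm_taylor_space_le {e : SpaceTime → Plane} (he : ContDiff ℝ ∞ e) {H : ℝ}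
    (hH : ∀ z : SpaceTime, 0 ≤ z.1 → ‖fderiv ℝ (fderiv ℝ e) z‖ ≤ H) {t : ℝ} (ht : 0 ≤ t)
    (y h : Plane) :
    ‖e (t, y + h) - e (t, y) - fderiv ℝ e (t, y) (0, h)‖ ≤ H * ‖h‖ ^ 2 := by
  have hd : Differentiable ℝ e := he.differentiable (by simp)
  have hH0 : 0 ≤ H := (ContinuousLinearMap.opNorm_nonneg _).trans (hH (t, y) ht)
  have h1 : ∀ w ∈ Metric.closedBall y ‖h‖, HasFDerivWithinAt (fun w => e (t, w))
      ((fderiv ℝ e (t, w)).comp (ContinuousLinearMap.inr ℝ ℝ Plane))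
      (Metric.closedBall y ‖h‖) w := fun w _ =>
    ((hd (t, w)).hasFDerivAt.comp w (hasFDerivAt_prodMk_right t w)).hasFDerivWithinAt
  have h2 := (convex_closedBall y ‖h‖).norm_image_sub_le_of_norm_hasFDerivWithin_le'
    (φ := (fderiv ℝ e (t, y)).comp (ContinuousLinearMap.inr ℝ ℝ Plane)) (C := H * ‖h‖) h1
    (fun w hw => by
      refine ContinuousLinearMap.opNorm_le_bound _ (by positivity) fun k => ?_
      have h3 := (fderiv ℝ e (t, w) - fderiv ℝ e (t, y)).le_of_opNorm_le
        (norm_fderiv_sub_le he hH (z := (t, w)) (w := (t, y)) ht ht) (0, k)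
      have h4 : ‖((t, w) : SpaceTime) - (t, y)‖ ≤ ‖h‖ := by
        rw [Metric.mem_closedBall, dist_eq_norm] at hw
        simpa using hw
      have h5 : ‖((0, k) : SpaceTime)‖ = ‖k‖ := by simp
      rw [h5] at h3
      refine le_trans (le_of_eq ?_) (h3.trans ?_)
      · simp
      · gcongr)
    (Metric.mem_closedBall_self (norm_nonneg h))
    (show y + h ∈ Metric.closedBall y ‖h‖ by simp)
  simp only [add_sub_cancel_left] at h2
  refine le_of_eq_of_le ?_ (h2.trans_eq (by ring))
  simp

variable {E e : SpaceTime → Plane} {M L K H δ ε τ t W : ℝ} {x₀ v₀ : Plane} {x v : ℝ → Plane}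
  {yd vd : ℕ → Plane}

/-- Error term in the averaged guiding center equations. -/
noncomputable def averagingError (M K H δ ε W : ℝ) : ℝ :=
  2 * δ + H * (ε * W) ^ 2 + ε ^ 3 * (H * (1 + M) * W) + ε ^ 2 * (K * M)

theorem norm_field_expansion_le (he : IsSmoothApprox E e L K δ)
    (hH : ∀ z : SpaceTime, 0 ≤ z.1 → ‖fderiv ℝ (fderiv ℝ e) z‖ ≤ H) (hε : 0 < ε) (ht : 0 ≤ t)
    (y : Plane) {w : Plane} (hw : ‖w‖ ≤ W) :
    ‖E (t, y + ε • perp w) - E (t, y) - fderiv ℝ e (t, y) (0, ε • perp w)‖ ≤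
      2 * δ + H * (ε * W) ^ 2 := by
  have hH0 : 0 ≤ H := (ContinuousLinearMap.opNorm_nonneg _).trans (hH (t, y) ht)
  have e1 : E (t, y + ε • perp w) - E (t, y) - fderiv ℝ e (t, y) (0, ε • perp w) =
      (E (t, y + ε • perp w) - e (t, y + ε • perp w)) - (E (t, y) - e (t, y)) +
      (e (t, y + ε • perp w) - e (t, y) - fderiv ℝ e (t, y) (0, ε • perp w)) := by abel
  rw [e1]
  refine (norm_add_le _ _).trans (add_le_add ((norm_sub_le _ _).trans ?_)
    ((norm_taylor_space_le he.contDiff hH ht y _).trans ?_))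
  · linarith [he.close (t, y + ε • perp w) ht, he.close (t, y) ht]
  · rw [norm_smul, norm_perp, Real.norm_of_nonneg hε.le]
    gcongr

/-- Continuous averaging: with the oscillating part of the drift absorbed into a corrector, the
guiding center follows the limiting dynamics up to second order in `ε`. -/
theorem IsCharacteristic.consistency_corrected (hE : IsLipField E M L K)
    (he : IsSmoothApprox E e L K δ)
    (hH : ∀ z : SpaceTime, 0 ≤ z.1 → ‖fderiv ℝ (fderiv ℝ e) z‖ ≤ H)
    (h : IsCharacteristic E ε x₀ v₀ x v) (hε : 0 < ε) (hτ : 0 < τ) (ht : 0 ≤ t)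
    (hW : ∀ s ∈ Icc t (t + τ), ‖v s‖ ≤ W) :
    ‖(guidingCenter ε x v (t + τ) - ε ^ 3 •
          perp (fderiv ℝ e (t + τ, guidingCenter ε x v (t + τ)) (0, v (t + τ)))) -
        (guidingCenter ε x v t - ε ^ 3 • perp (fderiv ℝ e (t, guidingCenter ε x v t) (0, v t)) -
        τ • perp (E (t, guidingCenter ε x v t)))‖ ≤
      τ * (averagingError M K H δ ε W + (L * τ + K * (M * τ))) := by
  obtain ⟨hM, hL, hK⟩ := hE.nonneg
  have hmem : t ∈ Icc t (t + τ) := left_mem_Icc.2 (by linarith)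
  have hH0 : 0 ≤ H := (ContinuousLinearMap.opNorm_nonneg _).trans (hH (t, 0) ht)
  have hd : Differentiable ℝ (fderiv ℝ e) :=
    (he.contDiff.fderiv_right (m := 1) (by norm_cast)).differentiable (by simp)
  set Y := guidingCenter ε x v with hY
  -- The corrector is based at the slow point `Y s` rather than `x s`, so differentiating its
  -- coefficient produces no factor `ε⁻¹`.
  let D2 : ℝ → Plane := fun s => fderiv ℝ (fderiv ℝ e) (s, Y s) (1, -perp (E (s, x s))) (0, v s)
  let f' : ℝ → Plane := fun s => -perp (E (s, x s)) - ε ^ 3 • perp (D2 s +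
    fderiv ℝ e (s, Y s) (0, ε⁻¹ • (E (s, x s) - ε⁻¹ • perp (v s))))
  have hf : ∀ s, 0 ≤ s → HasDerivWithinAt
      (fun s => Y s - ε ^ 3 • perpCLM (fderiv ℝ e (s, Y s) (0, v s))) (f' s) (Ici 0) s := by
    intro s hs
    have hYs := h.hasDerivWithinAt_guidingCenter hε s hs
    have h1 : HasDerivWithinAt (fun s => fderiv ℝ e (s, Y s))
        (fderiv ℝ (fderiv ℝ e) (s, Y s) (1, -perp (E (s, x s)))) (Ici 0) s :=
      (hd (s, Y s)).hasFDerivAt.comp_hasDerivWithinAt s ((hasDerivWithinAt_id s _).prodMk hYs)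
    have h2 := h1.clm_apply ((hasDerivWithinAt_const s (Ici 0) (0 : ℝ)).prodMk (h.deriv_v s hs))
    exact hYs.sub ((perpCLM.hasFDerivAt.comp_hasDerivWithinAt s h2).const_smul (ε ^ 3))
  have key := norm_step_le hf ht hτ (c := -perp (E (t, Y t)))
    (B := averagingError M K H δ ε W + (L * τ + K * (M * τ)))
    (fun s hs => by
      have hs0 : 0 ≤ s := ht.trans hs.1
      set B := (fderiv ℝ e (s, Y s)).comp (ContinuousLinearMap.inr ℝ ℝ Plane) with hB
      have hBapp : ∀ w, fderiv ℝ e (s, Y s) (0, w) = B w := fun w => by simp [hB]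
      have e1 : f' s - -perp (E (t, Y t)) =
          -perp ((E (s, Y s + ε • perp (v s)) - E (s, Y s) - fderiv ℝ e (s, Y s)
            (0, ε • perp (v s))) + ε ^ 3 • D2 s + ε ^ 2 • fderiv ℝ e (s, Y s) (0, E (s, x s)) +
            (E (s, Y s) - E (t, Y t))) := by
        rw [hY, guidingCenter_add, ← hY]
        simp only [f', hBapp, map_smul, map_sub, perp_add, perp_sub, perp_smul]
        match_scalars <;> field_simp <;> ring
      rw [e1, norm_neg, norm_perp]
      have hD2 : ‖D2 s‖ ≤ H * (1 + M) * W := by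
        have h1 : ‖((1, -perp (E (s, x s))) : SpaceTime)‖ ≤ 1 + M := by
          rw [Prod.norm_def]
          simp only [norm_one, norm_neg, norm_perp]
          have := hE.bound s (x s) hs0
          exact max_le (by linarith) (by linarith)
        have h2 := (fderiv ℝ (fderiv ℝ e) (s, Y s)).le_of_opNorm_le_of_le
          (hH (s, Y s) hs0) h1
        refine ContinuousLinearMap.le_of_opNorm_le_of_le _ h2 ?_
        simpa using hW s hs
      have h3 := he.bound_x (s, Y s) hs0 (E (s, x s))
      have h4 := hE.norm_sub_le_of_mem ht hs (Y s) (Y t)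
      have h5 := h.norm_guidingCenter_sub_le hE hε ht hs hmem
      unfold averagingError
      refine (norm_add_le _ _).trans (add_le_add ((norm_add_le _ _).trans (add_le_add
        ((norm_add_le _ _).trans (add_le_add ?_ ?_)) ?_)) ?_)
      · exact norm_field_expansion_le he hH hε hs0 _ (hW s hs)
      · rw [norm_smul, Real.norm_of_nonneg (by positivity)]
        gcongr
      · rw [norm_smul, Real.norm_of_nonneg (by positivity)]
        gcongr
        refine h3.trans ?_
        gcongr
        exact hE.bound _ _ hs0
      · refine h4.trans ?_
        gcongr)
  refine le_of_eq_of_le (congrArg _ ?_) key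
  simp only [perpCLM_apply]
  module

/-- Discrete averaging: the analogue of `IsCharacteristic.consistency_corrected` for the scheme. -/
theorem IsScheme.consistency_corrected (hE : IsLipField E M L K)
    (he : IsSmoothApprox E e L K δ)
    (hH : ∀ z : SpaceTime, 0 ≤ z.1 → ‖fderiv ℝ (fderiv ℝ e) z‖ ≤ H)
    (hd : IsScheme E ε τ x₀ v₀ yd vd) (hε : 0 < ε) (hτ : 0 < τ) (k : ℕ)
    (hW : ‖vd (k + 1)‖ ≤ W) :
    ‖(yd (k + 1) - ε ^ 3 • perp (fderiv ℝ e ((k + 1 : ℕ) * τ, yd (k + 1)) (0, vd (k + 1)))) -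
        (yd k - ε ^ 3 • perp (fderiv ℝ e (k * τ, yd k) (0, vd k)) -
        τ • perp (E (k * τ, yd k)))‖ ≤ τ * averagingError M K H δ ε W := by
  obtain ⟨hM, hL, hK⟩ := hE.nonneg
  have hkτ : (0 : ℝ) ≤ k * τ := by positivity
  have hkτ' : (0 : ℝ) ≤ (k + 1 : ℕ) * τ := by positivity
  have hH0 : 0 ≤ H := (ContinuousLinearMap.opNorm_nonneg _).trans (hH (k * τ, 0) hkτ)
  set B := (fderiv ℝ e (k * τ, yd k)).comp (ContinuousLinearMap.inr ℝ ℝ Plane) with hB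
  have hBapp : ∀ w, fderiv ℝ e (k * τ, yd k) (0, w) = B w := fun w => by simp [hB]
  set F := E (k * τ, yd k + ε • perp (vd k))
  set d := (fderiv ℝ e ((k + 1 : ℕ) * τ, yd (k + 1)) - fderiv ℝ e (k * τ, yd k)) (0, vd (k + 1))
    with hd_def
  -- Multiplied by `ε³`, this velocity step turns the jump of the corrector into the linear term `τ
  -- B (ε v^⊥)` to be cancelled, plus a term of order `τ ε²`.
  have hvB : B (vd k) = B (vd (k + 1)) + (τ / ε ^ 2) • B (perp (vd (k + 1))) - (τ / ε) • B F := by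
    rw [← map_smul, ← map_smul, ← map_add, ← map_sub, hd.v_succ hε hτ k, add_sub_cancel_right]
  have hnew : fderiv ℝ e ((k + 1 : ℕ) * τ, yd (k + 1)) (0, vd (k + 1)) = B (vd (k + 1)) + d := by
    rw [← hBapp, hd_def, _root_.sub_apply]; abel
  have e1 : (yd (k + 1) -
        ε ^ 3 • perp (fderiv ℝ e ((k + 1 : ℕ) * τ, yd (k + 1)) (0, vd (k + 1)))) -
      (yd k - ε ^ 3 • perp (fderiv ℝ e (k * τ, yd k) (0, vd k)) - τ • perp (E (k * τ, yd k))) =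
      -perp (τ • (E (k * τ, yd k + ε • perp (vd (k + 1))) - E (k * τ, yd k) -
        fderiv ℝ e (k * τ, yd k) (0, ε • perp (vd (k + 1)))) + ε ^ 3 • d +
        (τ * ε ^ 2) • B F) := by
    rw [hnew, hd.y_succ hτ k, hBapp, hBapp, hvB, map_smul]
    simp only [perp_add, perp_sub, perp_smul]
    match_scalars <;> field_simp <;> ring
  have hy : ‖yd (k + 1) - yd k‖ ≤ M * τ := by
    rw [hd.y_succ hτ k, sub_sub_cancel_left, norm_neg, norm_smul, norm_perp,
      Real.norm_of_nonneg hτ.le, mul_comm]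
    gcongr
    exact hE.bound _ _ hkτ
  have hdn : ‖d‖ ≤ τ * (H * (1 + M) * W) := by
    have h1 := norm_fderiv_sub_le he.contDiff hH (z := ((k + 1 : ℕ) * τ, yd (k + 1)))
      (w := (k * τ, yd k)) hkτ' hkτ
    have h2 : ‖((((k + 1 : ℕ) * τ, yd (k + 1)) : SpaceTime) - (k * τ, yd k))‖ ≤ (1 + M) * τ := by
      rw [Prod.mk_sub_mk, add_one_mul_step, add_sub_cancel_left, Prod.norm_def]
      have h3 : ‖τ‖ = τ := Real.norm_of_nonneg hτ.le
      have h4 : 0 ≤ M * τ := by positivity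
      exact max_le (by simp only [h3]; linarith) (by simp only; linarith)
    have h5 : ‖((0, vd (k + 1)) : SpaceTime)‖ ≤ W := by simpa using hW
    calc ‖d‖ ≤ (H * ((1 + M) * τ)) * W :=
          ContinuousLinearMap.le_of_opNorm_le_of_le _
            (h1.trans (mul_le_mul_of_nonneg_left h2 hH0)) h5
      _ = _ := by ring
  have hBF : ‖B F‖ ≤ K * M := by
    rw [← hBapp]
    refine (he.bound_x (k * τ, yd k) hkτ F).trans ?_
    gcongr
    exact hE.bound _ _ hkτ
  have h6 := norm_field_expansion_le he hH hε hkτ (yd k) hW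
  rw [e1, norm_neg, norm_perp]
  calc _ ≤ τ * (2 * δ + H * (ε * W) ^ 2) + ε ^ 3 * (τ * (H * (1 + M) * W)) +
        τ * ε ^ 2 * (K * M) := by
        refine (norm_add_le _ _).trans (add_le_add ((norm_add_le _ _).trans (add_le_add ?_ ?_)) ?_)
        all_goals
          rw [norm_smul, Real.norm_of_nonneg (by positivity)]
          gcongr
    _ = _ := by rw [averagingError]; ring

/-- Error on the guiding center, of second order in `ε` uniformly with respect to the stiffness. -/
theorem IsScheme.guidingCenter_error_le_sq (hE : IsLipField E M L K)
    (happ : ∀ δ > 0, ∃ e, IsSmoothApprox E e L K δ ∧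
      ∀ z : SpaceTime, 0 ≤ z.1 → ‖fderiv ℝ (fderiv ℝ e) z‖ ≤ H)
    (hε : 0 < ε) (hτ : 0 < τ)
    (h : IsCharacteristic E ε x₀ v₀ x v) (hd : IsScheme E ε τ x₀ v₀ yd vd) (n : ℕ) :
    ‖yd n - guidingCenter ε x v (n * τ)‖ ≤
      (n * τ * (τ * (L + K * M) +
        2 * averagingError M K H (ε ^ 2) ε (velocityFactor M L K ε ‖v₀‖ (n * τ)) +
        2 * K ^ 2 * ε ^ 3 * velocityFactor M L K ε ‖v₀‖ (n * τ)) +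
        2 * K * ε ^ 3 * velocityFactor M L K ε ‖v₀‖ (n * τ)) *
        Real.exp ((2 + K * τ) * K * (n * τ)) := by
  obtain ⟨hM, hL, hK⟩ := hE.nonneg
  have happ1 : ∀ δ > 0, ∃ e, IsSmoothApprox E e L K δ := fun δ hδ =>
    (happ δ hδ).imp fun e he => he.1
  -- With accuracy `ε²` the replacement of `E` by `e` is of the same order as the averaging error.
  obtain ⟨e, he, hH⟩ := happ (ε ^ 2) (by positivity)
  have hH0 : 0 ≤ H := (ContinuousLinearMap.opNorm_nonneg _).trans (hH (0, 0) le_rfl)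
  set Q := velocityFactor M L K ε ‖v₀‖ (n * τ) with hQ
  have hQ0 : 0 ≤ Q := velocityFactor_nonneg hE hε (norm_nonneg _) (by positivity)
  have hAQ : 0 ≤ averagingError M K H (ε ^ 2) ε Q := by unfold averagingError; positivity
  let Y := guidingCenter ε x v
  let G : ℕ → Plane := fun k =>
    yd k - ε ^ 3 • perp (fderiv ℝ e (k * τ, yd k) (0, vd k))
  let F : ℕ → Plane := fun k =>
    Y (k * τ) - ε ^ 3 • perp (fderiv ℝ e (k * τ, Y (k * τ)) (0, v (k * τ)))
  let a : ℕ → ℝ := fun k => ‖yd k - Y (k * τ)‖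
  let b : ℕ → ℝ := fun k => ‖G k - F k‖
  -- Removing the two correctors costs `ε³`. This is used in each Gronwall step, where the field
  -- difference involves uncorrected centers, and once more at the end.
  have hab : ∀ k ≤ n, a k ≤ b k + 2 * ε ^ 3 * (K * (Q * Real.exp (K * (k * τ)))) := by
    intro k hk
    have hkτ : (0 : ℝ) ≤ k * τ := by positivity
    obtain ⟨hWd, hWv⟩ := IsScheme.velocity_bounds hE happ1 hε hτ h hd hk
    have h1 := (he.bound_x (k * τ, yd k) hkτ (vd k)).trans (mul_le_mul_of_nonneg_left hWd hK)
    have h2 := (he.bound_x (k * τ, Y (k * τ)) hkτ (v (k * τ))).trans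
      (mul_le_mul_of_nonneg_left (hWv _ ⟨hkτ, le_rfl⟩) hK)
    have e1 : yd k - Y (k * τ) = (G k - F k) +
        ε ^ 3 • perp (fderiv ℝ e (k * τ, yd k) (0, vd k)) -
        ε ^ 3 • perp (fderiv ℝ e (k * τ, Y (k * τ)) (0, v (k * τ))) := by
      simp only [G, F]; abel
    have h3 : 0 ≤ ε ^ 3 := by positivity
    calc a k ≤ b k + ε ^ 3 * (K * (Q * Real.exp (K * (k * τ)))) +
          ε ^ 3 * (K * (Q * Real.exp (K * (k * τ)))) := by
          show ‖yd k - Y (k * τ)‖ ≤ _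
          rw [e1]
          refine (norm_sub_le _ _).trans (add_le_add ((norm_add_le _ _).trans
            (add_le_add le_rfl ?_)) ?_)
          all_goals
            rw [norm_smul, norm_perp, Real.norm_of_nonneg h3]
            gcongr
      _ = _ := by ring
  have key := discrete_gronwall_exp (s := b) (q := (2 + K * τ) * K * τ)
    (D := τ * (τ * (L + K * M) + 2 * averagingError M K H (ε ^ 2) ε Q + 2 * K ^ 2 * ε ^ 3 * Q))
    (by positivity) (by positivity) (by positivity) n ?_
  · have h0 : b 0 = 0 := by
      simp [b, G, F, Y, guidingCenter, h.init_x, h.init_v, hd.init_y, hd.init_v]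
    rw [h0, zero_add, growth_exponent_eq] at key
    have h1 : Real.exp (K * (n * τ)) ≤ Real.exp ((2 + K * τ) * K * (n * τ)) := by
      rw [Real.exp_le_exp]
      have h2 : 0 ≤ K * (n * τ) := by positivity
      have h3 : 0 ≤ K * τ * (K * (n * τ)) := by positivity
      linarith
    have h4 : 2 * ε ^ 3 * (K * (Q * Real.exp (K * (n * τ)))) ≤
        2 * ε ^ 3 * (K * (Q * Real.exp ((2 + K * τ) * K * (n * τ)))) := by gcongr
    exact (hab n le_rfl).trans ((add_le_add key h4).trans_eq (by ring))
  intro k hk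
  obtain ⟨hexp1, -, hexp3⟩ := exp_growth hK hτ k
  set X := Real.exp (K * ((k + 1 : ℕ) * τ)) with hX
  have hW0 : 0 ≤ Q * X := by positivity
  have hkτ : (0 : ℝ) ≤ k * τ := by positivity
  obtain ⟨hWd, hWv⟩ := IsScheme.velocity_bounds hE happ1 hε hτ h hd (Nat.succ_le_of_lt hk)
  have hWv : ∀ s ∈ Icc (k * τ) (k * τ + τ), ‖v s‖ ≤ Q * X := fun s hs =>
    hWv s ⟨hkτ.trans hs.1, by rw [add_one_mul_step]; exact hs.2⟩
  have hc := h.consistency_corrected hE he hH hε hτ hkτ hWv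
  have hcd := hd.consistency_corrected hE he hH hε hτ k hWd
  rw [← add_one_mul_step] at hc
  have e1 : G (k + 1) - F (k + 1) = (G k - F k) -
      τ • perp (E (k * τ, yd k) - E (k * τ, Y (k * τ))) +
      (G (k + 1) - (G k - τ • perp (E (k * τ, yd k)))) -
      (F (k + 1) - (F k - τ • perp (E (k * τ, Y (k * τ))))) := by
    rw [perp_sub]; module
  -- The Taylor remainder is quadratic in the velocity, so it uses the full `X ^ 2` allowed by the
  -- Gronwall rate.
  have hA : averagingError M K H (ε ^ 2) ε (Q * X) ≤
      averagingError M K H (ε ^ 2) ε Q * X ^ 2 := by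
    have h5 : X ≤ X ^ 2 := by nlinarith
    have h6 : 1 ≤ X ^ 2 := hexp1.trans h5
    unfold averagingError
    have h7 : 2 * ε ^ 2 ≤ 2 * ε ^ 2 * X ^ 2 := le_mul_of_one_le_right (by positivity) h6
    have h8 : ε ^ 2 * (K * M) ≤ ε ^ 2 * (K * M) * X ^ 2 :=
      le_mul_of_one_le_right (by positivity) h6
    have h9 : ε ^ 3 * (H * (1 + M) * Q) * X ≤ ε ^ 3 * (H * (1 + M) * Q) * X ^ 2 := by gcongr
    linarith
  have hXk : Real.exp (K * (k * τ)) ≤ X ^ 2 := by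
    have h5 : Real.exp (K * (k * τ)) ≤ X := by
      rw [hX, add_one_mul_step]; gcongr; linarith
    nlinarith
  have h6 : 1 ≤ X ^ 2 := by nlinarith
  calc b (k + 1) ≤ b k + τ * (K * a k) + τ * averagingError M K H (ε ^ 2) ε (Q * X) +
        τ * (averagingError M K H (ε ^ 2) ε (Q * X) + (L * τ + K * (M * τ))) := by
        show ‖G (k + 1) - F (k + 1)‖ ≤ _
        rw [e1]
        refine (norm_sub_le _ _).trans (add_le_add ((norm_add_le _ _).trans (add_le_add
          ((norm_sub_le _ _).trans (add_le_add le_rfl ?_)) hcd)) hc)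
        rw [norm_smul, norm_perp, Real.norm_of_nonneg hτ.le]
        gcongr
        exact hE.lip_x _ _ _ hkτ
    _ ≤ b k + τ * (K * (b k + 2 * ε ^ 3 * (K * (Q * X ^ 2)))) +
        τ * (averagingError M K H (ε ^ 2) ε Q * X ^ 2) +
        τ * (averagingError M K H (ε ^ 2) ε Q * X ^ 2 + (L * τ + K * (M * τ)) * X ^ 2) := by
        have h7 : L * τ + K * (M * τ) ≤ (L * τ + K * (M * τ)) * X ^ 2 :=
          le_mul_of_one_le_right (by positivity) h6
        have h8 := hab k hk.le
        gcongr
        refine h8.trans ?_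
        gcongr
    _ = (1 + K * τ) * b k + τ * (τ * (L + K * M) + 2 * averagingError M K H (ε ^ 2) ε Q +
        2 * K ^ 2 * ε ^ 3 * Q) * X ^ 2 := by ring
    _ ≤ _ := by
        have h7 : 1 + K * τ ≤ 1 + (2 + K * τ) * K * τ := by
          have : 0 ≤ K * τ := by positivity
          nlinarith
        have h8 : 0 ≤ b k := norm_nonneg _
        gcongr

end SecondOrderEstimates

/-! ### Absorbing the prefactors into one constant. -/

section UniformConstants

variable {M L K H A T b ε τ : ℝ}

/-- Once `τ / ε³` is factored out, every remaining power of `ε` is bounded by `(1 + b + ε)(1 + ε²)`.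
Time enters through the number of steps and the linear growth of the velocity factor, as `T (1 +
T)`. -/
theorem stiff_prefactor_le (hM : 0 ≤ M) (hL : 0 ≤ L) (hK : 0 ≤ K) (hA : 0 ≤ A) (hT : 0 ≤ T)
    (hb : 0 ≤ b) (hε : 0 < ε) (hτ : 0 < τ) :
    T * (τ * (2 * L + 2 * K * M + M / ε ^ 2 +
        (2 * K / ε + 1 / ε ^ 3) * (A * (1 + T) * (b + ε)))) ≤
      2 * (2 * L + 2 * K * M + M + (2 * K + 1) * A) *
        ((1 + T ^ 3) * (1 + b + ε) * (τ / ε ^ 3 * (1 + ε ^ 2))) := by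
  have hTP : T * (1 + T) ≤ 2 * (1 + T ^ 3) := by
    nlinarith [mul_nonneg hT (sq_nonneg (T - 1)), sq_nonneg (T - 1)]
  have h1 : ε ^ 3 ≤ (1 + b + ε) * (1 + ε ^ 2) := by
    have : 0 ≤ b * (1 + ε ^ 2) := by positivity
    nlinarith [sq_nonneg ε]
  have h2 : ε ≤ (1 + b + ε) * (1 + ε ^ 2) := by
    have : 0 ≤ b * (1 + ε ^ 2) := by positivity
    have : 0 ≤ ε ^ 3 := by positivity
    nlinarith [sq_nonneg ε]
  have h3 : (2 * K * ε ^ 2 + 1) * (b + ε) ≤ (2 * K + 1) * ((1 + b + ε) * (1 + ε ^ 2)) := by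
    have : (2 * K * ε ^ 2 + 1) ≤ (2 * K + 1) * (1 + ε ^ 2) := by nlinarith [sq_nonneg ε]
    calc _ ≤ (2 * K + 1) * (1 + ε ^ 2) * (1 + b + ε) := by gcongr; linarith
      _ = _ := by ring
  calc _ = T * (τ / ε ^ 3) * ((2 * L + 2 * K * M) * ε ^ 3 + M * ε +
        A * (1 + T) * ((2 * K * ε ^ 2 + 1) * (b + ε))) := by field_simp
    _ ≤ T * (τ / ε ^ 3) * ((2 * L + 2 * K * M) * ((1 + b + ε) * (1 + ε ^ 2)) * (1 + T) +
        M * ((1 + b + ε) * (1 + ε ^ 2)) * (1 + T) +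
        A * (1 + T) * ((2 * K + 1) * ((1 + b + ε) * (1 + ε ^ 2)))) := by
        have h4 : (2 * L + 2 * K * M) * ε ^ 3 ≤
            (2 * L + 2 * K * M) * ((1 + b + ε) * (1 + ε ^ 2)) * (1 + T) :=
          (mul_le_mul_of_nonneg_left h1 (by positivity)).trans
            (le_mul_of_one_le_right (by positivity) (by linarith))
        have h5 : M * ε ≤ M * ((1 + b + ε) * (1 + ε ^ 2)) * (1 + T) :=
          (mul_le_mul_of_nonneg_left h2 (by positivity)).trans
            (le_mul_of_one_le_right (by positivity) (by linarith))
        gcongr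
    _ = (T * (1 + T)) * ((2 * L + 2 * K * M + M + (2 * K + 1) * A) *
        ((1 + b + ε) * (τ / ε ^ 3 * (1 + ε ^ 2)))) := by ring
    _ ≤ (2 * (1 + T ^ 3)) * ((2 * L + 2 * K * M + M + (2 * K + 1) * A) *
        ((1 + b + ε) * (τ / ε ^ 3 * (1 + ε ^ 2)))) := by gcongr
    _ = _ := by ring

theorem stiff_prefactor_le_sq (hM : 0 ≤ M) (hL : 0 ≤ L) (hK : 0 ≤ K) (hA : 0 ≤ A) (hT : 0 ≤ T)
    (hε : 0 < ε) (hτ : 0 < τ) :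
    T * (τ * (2 * L + 2 * K * M + M / ε ^ 2 +
        (2 * K / ε + 1 / ε ^ 3) * (A * (1 + T) * (b + ε)))) ≤
      2 * (2 * L + 2 * K * M + M + 2 * (2 * K + 1) * A) *
        ((1 + T ^ 4) * (1 + b ^ 2 + ε ^ 2) * (τ / ε ^ 3 * (1 + ε))) := by
  have hTP : T * (1 + T) ≤ 2 * (1 + T ^ 4) := by
    nlinarith [sq_nonneg (T - 1), sq_nonneg (T ^ 2 - 1)]
  have h0 : 0 ≤ b ^ 2 * (1 + ε) := by positivity
  have h0' : 0 ≤ ε ^ 3 := by positivity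
  have h1 : ε ^ 3 ≤ (1 + b ^ 2 + ε ^ 2) * (1 + ε) := by nlinarith [sq_nonneg ε]
  have h2 : ε ≤ (1 + b ^ 2 + ε ^ 2) * (1 + ε) := by nlinarith [sq_nonneg ε]
  have h3 : (2 * K * ε ^ 2 + 1) * (b + ε) ≤
      2 * (2 * K + 1) * ((1 + b ^ 2 + ε ^ 2) * (1 + ε)) := by
    have h4 : ε ^ 2 * (b + ε) ≤ 2 * ((1 + b ^ 2 + ε ^ 2) * (1 + ε)) := by
      nlinarith [mul_nonneg hε.le (sq_nonneg (b - ε)), sq_nonneg ε, mul_nonneg hε.le (sq_nonneg b)]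
    have h5 : b + ε ≤ 2 * ((1 + b ^ 2 + ε ^ 2) * (1 + ε)) := by
      nlinarith [sq_nonneg (b - 1), sq_nonneg ε]
    nlinarith
  calc _ = T * (τ / ε ^ 3) * ((2 * L + 2 * K * M) * ε ^ 3 + M * ε +
        A * (1 + T) * ((2 * K * ε ^ 2 + 1) * (b + ε))) := by field_simp
    _ ≤ T * (τ / ε ^ 3) * ((2 * L + 2 * K * M) * ((1 + b ^ 2 + ε ^ 2) * (1 + ε)) * (1 + T) +
        M * ((1 + b ^ 2 + ε ^ 2) * (1 + ε)) * (1 + T) +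
        A * (1 + T) * (2 * (2 * K + 1) * ((1 + b ^ 2 + ε ^ 2) * (1 + ε)))) := by
        have h4 : (2 * L + 2 * K * M) * ε ^ 3 ≤
            (2 * L + 2 * K * M) * ((1 + b ^ 2 + ε ^ 2) * (1 + ε)) * (1 + T) :=
          (mul_le_mul_of_nonneg_left h1 (by positivity)).trans
            (le_mul_of_one_le_right (by positivity) (by linarith))
        have h5 : M * ε ≤ M * ((1 + b ^ 2 + ε ^ 2) * (1 + ε)) * (1 + T) :=
          (mul_le_mul_of_nonneg_left h2 (by positivity)).trans
            (le_mul_of_one_le_right (by positivity) (by linarith))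
        gcongr
    _ = (T * (1 + T)) * ((2 * L + 2 * K * M + M + 2 * (2 * K + 1) * A) *
        ((1 + b ^ 2 + ε ^ 2) * (τ / ε ^ 3 * (1 + ε)))) := by ring
    _ ≤ (2 * (1 + T ^ 4)) * ((2 * L + 2 * K * M + M + 2 * (2 * K + 1) * A) *
        ((1 + b ^ 2 + ε ^ 2) * (τ / ε ^ 3 * (1 + ε)))) := by gcongr
    _ = _ := by ring

theorem uniform_prefactor_le (hM : 0 ≤ M) (hL : 0 ≤ L) (hK : 0 ≤ K) (hA : 0 ≤ A) (hT : 0 ≤ T)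
    (hb : 0 ≤ b) (hε : 0 < ε) (hτ : 0 < τ) :
    T * (τ * (L + K * M) + 2 * K * ε * (A * (1 + T) * (b + ε))) +
        2 * ε * (A * (1 + T) * (b + ε)) ≤
      4 * (L + K * M + 2 * (K + 1) * A) * ((1 + T ^ 3) * (1 + b + ε) * (τ + ε)) := by
  have hTP : (1 + T) ^ 2 ≤ 4 * (1 + T ^ 3) := by
    nlinarith [mul_nonneg hT (sq_nonneg (T - 1)), sq_nonneg (T - 1), sq_nonneg (T + 1)]
  have h1 : T ≤ (1 + T) ^ 2 := by nlinarith
  have h2 : T * (1 + T) ≤ (1 + T) ^ 2 := by nlinarith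
  have h3 : 1 + T ≤ (1 + T) ^ 2 := by nlinarith
  have h4 : τ ≤ (1 + b + ε) * (τ + ε) := by
    have : 0 ≤ (b + ε) * (τ + ε) := by positivity
    linarith
  have h5 : ε * (b + ε) ≤ (1 + b + ε) * (τ + ε) := by
    have : 0 ≤ (1 + b + ε) * τ := by positivity
    linarith
  calc _ = (L + K * M) * (T * τ) + 2 * K * A * (T * (1 + T) * (ε * (b + ε))) +
        2 * A * ((1 + T) * (ε * (b + ε))) := by ring
    _ ≤ (L + K * M) * ((1 + T) ^ 2 * ((1 + b + ε) * (τ + ε))) +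
        2 * K * A * ((1 + T) ^ 2 * ((1 + b + ε) * (τ + ε))) +
        2 * A * ((1 + T) ^ 2 * ((1 + b + ε) * (τ + ε))) := by gcongr
    _ = (1 + T) ^ 2 * ((L + K * M + 2 * (K + 1) * A) * ((1 + b + ε) * (τ + ε))) := by ring
    _ ≤ (4 * (1 + T ^ 3)) * ((L + K * M + 2 * (K + 1) * A) * ((1 + b + ε) * (τ + ε))) := by
        gcongr
    _ = _ := by ring

/-- The worst term is the quadratic Taylor remainder: it brings `T (1 + T)²` and `(b + ε)²`, hence
the squares of `‖v₀‖` and `ε` in the final estimate. -/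
theorem uniform_prefactor_le_sq (hM : 0 ≤ M) (hL : 0 ≤ L) (hK : 0 ≤ K) (hH : 0 ≤ H) (hA : 0 ≤ A)
    (hT : 0 ≤ T) (hb : 0 ≤ b) (hε : 0 < ε) (hτ : 0 < τ) :
    T * (τ * (L + K * M) + 2 * averagingError M K H (ε ^ 2) ε (A * (1 + T) * (b + ε)) +
        2 * K ^ 2 * ε ^ 3 * (A * (1 + T) * (b + ε))) +
        2 * K * ε ^ 3 * (A * (1 + T) * (b + ε)) ≤
      4 * (L + K * M + 2 * (2 + K * M) + 4 * H * A ^ 2 + 4 * (H * (1 + M)) * A + 4 * K ^ 2 * A +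
        4 * K * A) * ((1 + T ^ 4) * (1 + b ^ 2 + ε ^ 2) * (τ + ε ^ 2)) := by
  set N := 1 + b ^ 2 + ε ^ 2 with hN
  have hN1 : 1 ≤ N := by nlinarith [sq_nonneg b, sq_nonneg ε]
  set P := 4 * (1 + T ^ 4) with hP
  have hP1 : T ≤ P := by nlinarith [sq_nonneg (T - 1), sq_nonneg (T ^ 2 - 1)]
  have hP2 : T * (1 + T) ≤ P := by nlinarith [sq_nonneg (T - 1), sq_nonneg (T ^ 2 - 1)]
  have hP3 : T * (1 + T) ^ 2 ≤ P := by
    nlinarith [sq_nonneg (T - 1), sq_nonneg (T ^ 2 - 1), sq_nonneg (T ^ 2 - T)]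
  have hP4 : 1 + T ≤ P := by nlinarith [sq_nonneg (T - 1), sq_nonneg (T ^ 2 - 1)]
  have hP0 : 0 ≤ P := hT.trans hP1
  have hb1 : (b + ε) ^ 2 ≤ 2 * N := by nlinarith [sq_nonneg (b - ε)]
  have hb2 : ε * (b + ε) ≤ 2 * N := by nlinarith [sq_nonneg (b - ε), sq_nonneg b]
  have h1 : T * τ ≤ P * (N * (τ + ε ^ 2)) := by
    have : τ ≤ N * (τ + ε ^ 2) :=
      (le_add_of_nonneg_right (by positivity)).trans (le_mul_of_one_le_left (by positivity) hN1)
    gcongr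
  have h0 : N * ε ^ 2 ≤ N * (τ + ε ^ 2) := by gcongr; linarith
  have h2 : T * ε ^ 2 ≤ P * (N * (τ + ε ^ 2)) := by
    have : ε ^ 2 ≤ N * (τ + ε ^ 2) := (le_mul_of_one_le_left (by positivity) hN1).trans h0
    gcongr
  have h3 : T * (1 + T) ^ 2 * (ε ^ 2 * (b + ε) ^ 2) ≤ 2 * (P * (N * (τ + ε ^ 2))) := by
    have h4 : ε ^ 2 * (b + ε) ^ 2 ≤ 2 * (N * (τ + ε ^ 2)) := by
      nlinarith [mul_le_mul_of_nonneg_left hb1 (sq_nonneg ε)]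
    calc _ ≤ P * (2 * (N * (τ + ε ^ 2))) := by gcongr
      _ = _ := by ring
  have h5 : ε ^ 2 * (ε * (b + ε)) ≤ 2 * (N * (τ + ε ^ 2)) := by
    nlinarith [mul_le_mul_of_nonneg_left hb2 (sq_nonneg ε)]
  have h6 : T * (1 + T) * (ε ^ 2 * (ε * (b + ε))) ≤ 2 * (P * (N * (τ + ε ^ 2))) := by
    calc _ ≤ P * (2 * (N * (τ + ε ^ 2))) := by gcongr
      _ = _ := by ring
  have h7 : (1 + T) * (ε ^ 2 * (ε * (b + ε))) ≤ 2 * (P * (N * (τ + ε ^ 2))) := by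
    calc _ ≤ P * (2 * (N * (τ + ε ^ 2))) := by gcongr
      _ = _ := by ring
  calc _ = (L + K * M) * (T * τ) + 2 * (2 + K * M) * (T * ε ^ 2) +
        2 * H * A ^ 2 * (T * (1 + T) ^ 2 * (ε ^ 2 * (b + ε) ^ 2)) +
        2 * (H * (1 + M)) * A * (T * (1 + T) * (ε ^ 2 * (ε * (b + ε)))) +
        2 * K ^ 2 * A * (T * (1 + T) * (ε ^ 2 * (ε * (b + ε)))) +
        2 * K * A * ((1 + T) * (ε ^ 2 * (ε * (b + ε)))) := by
        unfold averagingError; ring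
    _ ≤ (L + K * M) * (P * (N * (τ + ε ^ 2))) + 2 * (2 + K * M) * (P * (N * (τ + ε ^ 2))) +
        2 * H * A ^ 2 * (2 * (P * (N * (τ + ε ^ 2)))) +
        2 * (H * (1 + M)) * A * (2 * (P * (N * (τ + ε ^ 2)))) +
        2 * K ^ 2 * A * (2 * (P * (N * (τ + ε ^ 2)))) +
        2 * K * A * (2 * (P * (N * (τ + ε ^ 2)))) := by gcongr
    _ = _ := by rw [hP]; ring

theorem le_add_mul_min {r C₁ C₂ P a b : ℝ} (hC₁ : 0 ≤ C₁) (hC₂ : 0 ≤ C₂) (hP : 0 ≤ P) (ha : 0 ≤ a)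
    (hb : 0 ≤ b) (h₁ : r ≤ C₁ * (P * a)) (h₂ : r ≤ C₂ * (P * b)) :
    r ≤ (C₁ + C₂) * (P * min a b) := by
  rw [add_mul]
  rcases min_choice a b with h | h <;> rw [h]
  · exact h₁.trans (le_add_of_nonneg_right (by positivity))
  · exact h₂.trans (le_add_of_nonneg_left (by positivity))

end UniformConstants

/-! ### Assembly of the two estimates and of the theorem. -/

theorem space_error_estimate {E : SpaceTime → Plane} {M L K : ℝ} (hE : IsLipField E M L K)
    (happ : ∀ δ > 0, ∃ e, IsSmoothApprox E e L K δ) :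
    ∃ C : ℝ, ∀ ε Δt : ℝ, 0 < ε → 0 < Δt → ∀ x₀ v₀ : Plane,
      ∀ x v : ℝ → Plane, IsCharacteristic E ε x₀ v₀ x v →
      ∀ yd vd : ℕ → Plane, IsScheme E ε Δt x₀ v₀ yd vd → ∀ n : ℕ,
        ‖(yd n + ε • perp (vd n)) - x (n * Δt)‖ ≤
          C * ((1 + (n * Δt) ^ 3) * Real.exp ((2 + K * Δt) * K * (n * Δt)) *
            (1 + ‖v₀‖ + ε) * min (Δt / ε ^ 3 * (1 + ε ^ 2)) (Δt + ε)) := by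
  obtain ⟨hM, hL, hK⟩ := hE.nonneg
  set A := 4 + 2 * M + L + K * (3 * M + 1) with hA_def
  have hA : 0 ≤ A := by positivity
  refine ⟨2 * (2 * L + 2 * K * M + M + (2 * K + 1) * A) + 4 * (L + K * M + 2 * (K + 1) * A), ?_⟩
  intro ε τ hε hτ x₀ v₀ x v h yd vd hd n
  set T : ℝ := n * τ with hT_def
  have hT : 0 ≤ T := by positivity
  set X := Real.exp ((2 + K * τ) * K * T) with hX
  have hX0 : 0 ≤ X := (Real.exp_pos _).le
  have hb : 0 ≤ ‖v₀‖ := norm_nonneg _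
  have h0 : ‖(yd n + ε • perp (vd n)) - x T‖ ≤
      ‖yd n - guidingCenter ε x v T‖ + ε * ‖vd n - v T‖ := by
    rw [← guidingCenter_add ε x v, add_sub_add_comm, ← smul_sub, ← perp_sub]
    refine (norm_add_le _ _).trans_eq ?_
    rw [norm_smul, norm_perp, Real.norm_of_nonneg hε.le]
  refine le_add_mul_min (by positivity) (by positivity) (by positivity) (by positivity)
    (by positivity) ?_ ?_
  · refine (h0.trans (hd.error_le hE happ hε hτ h n)).trans ?_
    calc _ ≤ (2 * (2 * L + 2 * K * M + M + (2 * K + 1) * A) *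
          ((1 + T ^ 3) * (1 + ‖v₀‖ + ε) * (τ / ε ^ 3 * (1 + ε ^ 2)))) * X :=
          mul_le_mul_of_nonneg_right (stiff_prefactor_le hM hL hK hA hT hb hε hτ) hX0
      _ = _ := by ring
  -- Here the velocities are not compared: in `x = y + ε v^⊥` the factor `ε` already makes their
  -- bounds sufficient.
  · have hexp : Real.exp (K * T) ≤ X := by
      rw [hX, Real.exp_le_exp]
      have h1 : 0 ≤ K * T := by positivity
      have h2 : 0 ≤ K * τ * (K * T) := by positivity
      linarith
    obtain ⟨hvd, hv⟩ := IsScheme.velocity_bounds hE happ hε hτ h hd (le_refl n)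
    have hQ0 := velocityFactor_nonneg hE hε hb hT
    have h1 : ‖vd n - v T‖ ≤ 2 * (velocityFactor M L K ε ‖v₀‖ T * X) := by
      have h2 : velocityFactor M L K ε ‖v₀‖ T * Real.exp (K * T) ≤
          velocityFactor M L K ε ‖v₀‖ T * X := by gcongr
      have h3 := hv T ⟨hT, le_rfl⟩
      linarith [norm_sub_le (vd n) (v T)]
    calc _ ≤ T * (τ * (L + K * M) + 2 * K * ε * velocityFactor M L K ε ‖v₀‖ T) * X +
          ε * (2 * (velocityFactor M L K ε ‖v₀‖ T * X)) :=
          h0.trans (add_le_add (hd.guidingCenter_error_le hE happ hε hτ h n) (by gcongr))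
      _ = (T * (τ * (L + K * M) + 2 * K * ε * (A * (1 + T) * (‖v₀‖ + ε))) +
          2 * ε * (A * (1 + T) * (‖v₀‖ + ε))) * X := by rw [velocityFactor]; ring
      _ ≤ (4 * (L + K * M + 2 * (K + 1) * A) * ((1 + T ^ 3) * (1 + ‖v₀‖ + ε) * (τ + ε))) * X :=
          mul_le_mul_of_nonneg_right (uniform_prefactor_le hM hL hK hA hT hb hε hτ) hX0
      _ = _ := by ring

theorem guidingCenter_error_estimate {E : SpaceTime → Plane} {M L K H : ℝ}
    (hE : IsLipField E M L K)
    (happ : ∀ δ > 0, ∃ e, IsSmoothApprox E e L K δ ∧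
      ∀ z : SpaceTime, 0 ≤ z.1 → ‖fderiv ℝ (fderiv ℝ e) z‖ ≤ H) :
    ∃ C : ℝ, ∀ ε Δt : ℝ, 0 < ε → 0 < Δt → ∀ x₀ v₀ : Plane,
      ∀ x v : ℝ → Plane, IsCharacteristic E ε x₀ v₀ x v →
      ∀ yd vd : ℕ → Plane, IsScheme E ε Δt x₀ v₀ yd vd → ∀ n : ℕ,
        ‖yd n - guidingCenter ε x v (n * Δt)‖ ≤
          C * ((1 + (n * Δt) ^ 4) * Real.exp ((2 + K * Δt) * K * (n * Δt)) *
            (1 + ‖v₀‖ ^ 2 + ε ^ 2) * min (Δt / ε ^ 3 * (1 + ε)) (Δt + ε ^ 2)) := by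
  obtain ⟨hM, hL, hK⟩ := hE.nonneg
  have happ1 : ∀ δ > 0, ∃ e, IsSmoothApprox E e L K δ := fun δ hδ =>
    (happ δ hδ).imp fun e he => he.1
  obtain ⟨e, -, hH⟩ := happ 1 one_pos
  have hH0 : 0 ≤ H := (ContinuousLinearMap.opNorm_nonneg _).trans (hH (0, 0) le_rfl)
  set A := 4 + 2 * M + L + K * (3 * M + 1) with hA_def
  have hA : 0 ≤ A := by positivity
  refine ⟨2 * (2 * L + 2 * K * M + M + 2 * (2 * K + 1) * A) +
    4 * (L + K * M + 2 * (2 + K * M) + 4 * H * A ^ 2 + 4 * (H * (1 + M)) * A + 4 * K ^ 2 * A +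
        4 * K * A), ?_⟩
  intro ε τ hε hτ x₀ v₀ x v h yd vd hd n
  set T : ℝ := n * τ with hT_def
  have hT : 0 ≤ T := by positivity
  set X := Real.exp ((2 + K * τ) * K * T) with hX
  have hX0 : 0 ≤ X := (Real.exp_pos _).le
  have hb : 0 ≤ ‖v₀‖ := norm_nonneg _
  refine le_add_mul_min (by positivity) (by positivity) (by positivity) (by positivity)
    (by positivity) ?_ ?_
  · have h0 : ‖yd n - guidingCenter ε x v T‖ ≤
        ‖yd n - guidingCenter ε x v T‖ + ε * ‖vd n - v T‖ :=
      le_add_of_nonneg_right (by positivity)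
    refine (h0.trans (hd.error_le hE happ1 hε hτ h n)).trans ?_
    calc _ ≤ (2 * (2 * L + 2 * K * M + M + 2 * (2 * K + 1) * A) *
          ((1 + T ^ 4) * (1 + ‖v₀‖ ^ 2 + ε ^ 2) * (τ / ε ^ 3 * (1 + ε)))) * X :=
          mul_le_mul_of_nonneg_right (stiff_prefactor_le_sq hM hL hK hA hT hε hτ) hX0
      _ = _ := by ring
  · refine (hd.guidingCenter_error_le_sq hE happ hε hτ h n).trans ?_
    calc _ ≤ (4 * (L + K * M + 2 * (2 + K * M) + 4 * H * A ^ 2 + 4 * (H * (1 + M)) * A +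
          4 * K ^ 2 * A + 4 * K * A) *
          ((1 + T ^ 4) * (1 + ‖v₀‖ ^ 2 + ε ^ 2) * (τ + ε ^ 2))) * X :=
          mul_le_mul_of_nonneg_right
            (uniform_prefactor_le_sq hM hL hK hH0 hA hT hb hε hτ) hX0
      _ = _ := by ring

theorem theorem4p1 (E : SpaceTime → Plane) :
    -- unique solvability of the scheme
    (∀ ε Δt : ℝ, 0 < ε → 0 < Δt → ∀ x₀ v₀ : Plane,
      ∃! p : (ℕ → Plane) × (ℕ → Plane), IsScheme E ε Δt x₀ v₀ p.1 p.2) ∧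
    -- error on the space variable `x = y + ε v^⊥`
    (IsSobolevField 1 E → ∃ C : ℝ, ∀ ε Δt : ℝ, 0 < ε → 0 < Δt → ∀ x₀ v₀ : Plane,
      ∀ x v : ℝ → Plane, IsCharacteristic E ε x₀ v₀ x v →
      ∀ yd vd : ℕ → Plane, IsScheme E ε Δt x₀ v₀ yd vd → ∀ n : ℕ,
        ‖(yd n + ε • perp (vd n)) - x (n * Δt)‖ ≤
          C * ((1 + (n * Δt) ^ 3) * Real.exp ((2 + Kx E * Δt) * Kx E * (n * Δt)) *
            (1 + ‖v₀‖ + ε) * min (Δt / ε ^ 3 * (1 + ε ^ 2)) (Δt + ε))) ∧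
    -- error on the guiding center variable `y = x - ε v^⊥`
    (IsSobolevField 2 E → ∃ C : ℝ, ∀ ε Δt : ℝ, 0 < ε → 0 < Δt → ∀ x₀ v₀ : Plane,
      ∀ x v : ℝ → Plane, IsCharacteristic E ε x₀ v₀ x v →
      ∀ yd vd : ℕ → Plane, IsScheme E ε Δt x₀ v₀ yd vd → ∀ n : ℕ,
        ‖yd n - (x (n * Δt) - ε • perp (v (n * Δt)))‖ ≤
          C * ((1 + (n * Δt) ^ 4) * Real.exp ((2 + Kx E * Δt) * Kx E * (n * Δt)) *
            (1 + ‖v₀‖ ^ 2 + ε ^ 2) * min (Δt / ε ^ 3 * (1 + ε)) (Δt + ε ^ 2))) := by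
  refine ⟨fun ε Δt hε hΔt x₀ v₀ => existsUnique_isScheme E hε hΔt x₀ v₀, fun hE => ?_,
    fun hE => ?_⟩
  · exact space_error_estimate hE.isLipField fun δ hδ => hE.exists_isSmoothApprox hδ
  · exact guidingCenter_error_estimate hE.one_of_two.isLipField fun δ hδ =>
      hE.exists_isSmoothApprox_two hδ
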